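/- Fix integers $N, n \ge 0$. Let $\mathcal U=\mathbb Z\langle u_1,\dots,u_N\rangle$ be the free associative algebra, whose monomials are identified with the words in the alphabet $\{1,\dots,N\}$, and let $\langle\cdot,\cdot\rangle$ be the symmetric bilinear form on $\mathcal U$ for which the monomials form an orthonormal basis. Put $e_d(\mathbf u)=\sum_{N\ge i_1>\cdots>i_d\ge1}u_{i_1}\cdots u_{i_d}$ for $d>0$, $e_0(\mathbf u)=1$, $e_d(\mathbf u)=0$ for $d<0$, and for a partition $\lambda$ with conjugate $\lambda'=(\lambda'_1,\dots,\lambda'_t)$ (where $t=\lambda_1$) put $$\mathfrak J_\lambda(\mathbf u)=\sum_{\pi\in S_t}\operatorname{sgn}(\pi)\,e_{\lambda'_1+\pi(1)-1}(\mathbf u)\,e_{\lambda'_2+\pi(2)-2}(\mathbf u)\cdots e_{\lambda'_t+\pi(t)-t}(\mathbf u).$$ Let $\mathcal W_n$ be the set of words of length $n$ in $\{1,\dots,N\}$ with no repeated letter. For letters $a<b<c$ and words $v,w$ such that the word $v\,abc\,w$ has no repeated letter, the KR$_i$ square given by $v,w,a,b,c$, where $i=|v|+2$, is the set $X=\{v\,bac\,w,\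 v\,bca\,w,\ v\,acb\,w,\ v\,cab\,w\}$. A partial D$_0$ graph of degree $n$ is a graph $H$ on a vertex set $W=V(H)\subseteq\mathcal W_n$, with edges colored from $\{2,\dots,n-1\}$ (two vertices may be joined by edges of several colors), such that for each KR$_i$ square $X$ exactly one of the following occurs: (i) $X\cap W=\varnothing$; (ii) $X\cap W$ is $\{v\,bac\,w,v\,bca\,w\}$ or $\{v\,acb\,w,v\,cab\,w\}$ and is an $i$-edge; (iii) $X\cap W$ is $\{v\,bac\,w,v\,acb\,w\}$ or $\{v\,bca\,w,v\,cab\,w\}$ and is an $i$-edge; (iv) $X\subseteq W$ and both pairs in (ii) are $i$-edges; (v) $X\subseteq W$ and both pairs in (iii) are $i$-edges; (vi) $X\subseteq W$ and no $i$-edge has both ends in $X$. It is a D$_0$ graph if (vi) never occurs. For a word $w=w_1\cdots w_n$ let $\mathrm{Des}(w)=\{i\in\{1,\dots,n-1\}: w_i>w_{i+1}\}$ and let $$Q_{\mathrm{Des}(w)}(\mathbf x)=\sum_{\substack{1\le i_1\le\cdots\le i_n\\ j\in\mathrm{Des}(w)\Rightarrow i_j<i_{j+1}}}x_{i_1}\cdots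 x_{i_n}$$ be Gessel's fundamental quasisymmetric function in the variables $x_1,x_2,\dots$. The generating function of $H$ is $\sum_{w\in V(H)}Q_{\mathrm{Des}(w)}(\mathbf x)$. **Corollary.** The generating function of any partial D$_0$ graph $H$ (in particular, of any D$_0$ graph) is a symmetric function. Hence it is in a unique way a finite integer linear combination of Schur functions $s_\lambda(\mathbf x)$, and for every partition $\lambda$ the coefficient of $s_\lambda(\mathbf x)$ in it equals $$\Big\langle \mathfrak J_\lambda(\mathbf u),\ \sum_{w\in V(H)}w\Big\rangle .$$ -/

import Mathlib

noncomputable section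

/-! ### The free associative algebra and noncommutative Schur functions -/

/-- Words in the alphabet `{1, 2, …, N}`, modelled as lists over `Fin N` (only the order of the
letters matters). -/
abbrev KRWord (N : ℕ) : Type := List (Fin N)

/-- The free associative algebra `ℤ⟨u_1, …, u_N⟩`, realized as the monoid algebra of the free
monoid, so that the words form a `ℤ`-basis and the product concatenates words. -/
abbrev FreeAlg (N : ℕ) : Type := MonoidAlgebra ℤ (FreeMonoid (Fin N))

/-- The monomial of the free associative algebra given by a word. -/
def wordMonomial {N : ℕ} (w : KRWord N) : FreeAlg N :=
  MonoidAlgebra.single (FreeMonoid.ofList w) 1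

/-- The symmetric bilinear form on the free associative algebra for which the monomials form an
orthonormal basis: `⟨f, g⟩ = ∑_w f_w g_w`. -/
def wordPairing {N : ℕ} (f g : FreeAlg N) : ℤ :=
  f.coeff.sum fun w a => a * g.coeff w

open Classical in
/-- The noncommutative elementary symmetric function
`e_d(u) = ∑_{N ≥ i_1 > ⋯ > i_d ≥ 1} u_{i_1} ⋯ u_{i_d}`, with `e_d(u) = 0` for `d < 0`.
For `d = 0` the only summand is the empty word, so `e_0(u) = 1`. -/
def ncElementary (N : ℕ) (d : ℤ) : FreeAlg N :=
  if 0 ≤ d then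
    ∑ i : Fin d.toNat → Fin N with StrictAnti i, wordMonomial (List.ofFn i)
  else 0

/-- The noncommutative Schur function
`𝔍_μ(u) = ∑_{π ∈ S_t} sgn(π) e_{μ'_1 + π(1) - 1}(u) ⋯ e_{μ'_t + π(t) - t}(u)`, where
`μ' = (μ'_1, …, μ'_t)` is the conjugate partition of `μ`, that is, the list of the column lengths
of `μ`, and `t` is the length of the first row. The indices below start at `0`, which leaves the
differences `π(j) - j` unchanged. The factors are multiplied in increasing order of `j`. -/
def ncSchur (N : ℕ) (μ : YoungDiagram) : FreeAlg N :=
  ∑ π : Equiv.Perm (Fin (μ.rowLen 0)),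
    (Equiv.Perm.sign π : ℤ) •
      (List.ofFn fun j : Fin (μ.rowLen 0) =>
        ncElementary N ((μ.colLen j : ℤ) + ((π j : ℕ) : ℤ) - ((j : ℕ) : ℤ))).prod

/-! ### Symmetric and quasisymmetric functions in the variables `x_0, x_1, x_2, …` -/

/-- `F` is a symmetric function in countably many variables: a formal power series of bounded
degree which is invariant under all permutations of the variables. -/
def IsSymmetricFunction (F : MvPowerSeries ℕ ℤ) : Prop :=
  (∃ d : ℕ, ∀ m : ℕ →₀ ℕ, MvPowerSeries.coeff m F ≠ 0 → m.degree ≤ d) ∧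
    ∀ σ : Equiv.Perm ℕ, MvPowerSeries.rename σ F = F

/-- The Schur function `s_μ(x) = ∑_T x^T`, the sum over all semistandard Young tableaux `T` of
shape `μ`: the coefficient of `x^m` is the number of those with content `m`. -/
def schurFunction (μ : YoungDiagram) : MvPowerSeries ℕ ℤ := fun m =>
  ({T : SemistandardYoungTableau μ |
    ∑ c ∈ μ.cells, Finsupp.single (T c.1 c.2) 1 = m}.ncard : ℤ)

/-- The descent set `{i ∈ [n-1] | w_i > w_{i+1}}` of the word `w = w_1 ⋯ w_n`. The entry `w_i` is
`w[i - 1]`, as lists are indexed from `0`. -/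
def descentSet {N : ℕ} (w : KRWord N) : Set ℕ :=
  {i | 1 ≤ i ∧ ∃ h : i < w.length, w[i] < w[i - 1]}

/-- Gessel's fundamental quasisymmetric function of degree `n`, for a set `D ⊆ [n-1]`:
the sum of `x_{i_1} ⋯ x_{i_n}` over all `i_1 ≤ ⋯ ≤ i_n` such that `i_j < i_{j+1}` for `j ∈ D`;
the coefficient of `x^m` is the number of such sequences with monomial `x^m`. The sequences are
indexed from `0`, so that the positions `j`, `j + 1` below are the `(j+1)`-st and the `(j+2)`-nd. -/
def fundamentalQuasisymmetric (n : ℕ) (D : Set ℕ) : MvPowerSeries ℕ ℤ := fun m =>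
  ({i : Fin n → ℕ | Monotone i ∧
      (∀ (j : ℕ) (h : j + 1 < n), j + 1 ∈ D → i ⟨j, Nat.lt_of_succ_lt h⟩ < i ⟨j + 1, h⟩) ∧
      ∑ j, Finsupp.single (i j) 1 = m}.ncard : ℤ)

/-! ### Partial D₀ graphs -/

/-- The words `v bac w`, `v bca w`, `v acb w`, `v cab w` are obtained from this one by taking for
`x y z` the respective three letters. -/
def insertTriple {N : ℕ} (v w : KRWord N) (x y z : Fin N) : KRWord N :=
  v ++ [x, y, z] ++ w

/-- The set of the four words of a KR square `(v bac w, v bca w, v acb w, v cab w)`. -/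
def krSquare {N : ℕ} (v w : KRWord N) (a b c : Fin N) : Set (KRWord N) :=
  {insertTriple v w b a c, insertTriple v w b c a,
    insertTriple v w a c b, insertTriple v w c a b}

/-- The six possibilities for a KR square `X` relative to a graph with vertex set `W`. -/
inductive KRPossibility : Type
  | disjoint
  | knuthPair
  | rotationPair
  | knuthFull
  | rotationFull
  | undetermined

/-- When a possibility occurs for the KR square `X` given by `v`, `w` and `a < b < c`, in a graph
with vertex set `W`; here `E` is the graph formed by the `i`-edges, where `i = |v| + 2`. -/
def KRPossibility.Occurs {N : ℕ} (W : Set (KRWord N)) (E : SimpleGraph (KRWord N))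
    (v w : KRWord N) (a b c : Fin N) : KRPossibility → Prop
  | .disjoint => krSquare v w a b c ∩ W = ∅
  | .knuthPair =>
      (krSquare v w a b c ∩ W = {insertTriple v w b a c, insertTriple v w b c a} ∧
        E.Adj (insertTriple v w b a c) (insertTriple v w b c a)) ∨
      (krSquare v w a b c ∩ W = {insertTriple v w a c b, insertTriple v w c a b} ∧
        E.Adj (insertTriple v w a c b) (insertTriple v w c a b))
  | .rotationPair =>
      (krSquare v w a b c ∩ W = {insertTriple v w b a c, insertTriple v w a c b} ∧
        E.Adj (insertTriple v w b a c) (insertTriple v w a c b)) ∨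
      (krSquare v w a b c ∩ W = {insertTriple v w b c a, insertTriple v w c a b} ∧
        E.Adj (insertTriple v w b c a) (insertTriple v w c a b))
  | .knuthFull =>
      krSquare v w a b c ⊆ W ∧
        E.Adj (insertTriple v w b a c) (insertTriple v w b c a) ∧
        E.Adj (insertTriple v w a c b) (insertTriple v w c a b)
  | .rotationFull =>
      krSquare v w a b c ⊆ W ∧
        E.Adj (insertTriple v w b a c) (insertTriple v w a c b) ∧
        E.Adj (insertTriple v w b c a) (insertTriple v w c a b)
  | .undetermined =>
      krSquare v w a b c ⊆ W ∧
        ∀ x ∈ krSquare v w a b c, ∀ y ∈ krSquare v w a b c, ¬ E.Adj x y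

/-- A partial D₀ graph of degree `n` in the alphabet `{1, …, N}`. Two vertices may be joined by
several edges of different colors, so the edges are given color by color. -/
structure PartialD0Graph (N n : ℕ) where
  /-- The vertex set. -/
  verts : Finset (KRWord N)
  /-- The vertices are words of length `n`. -/
  length_eq : ∀ w ∈ verts, w.length = n
  /-- The vertices are words with no repeated letter. -/
  nodup : ∀ w ∈ verts, w.Nodup
  /-- The graph formed by the `i`-edges. -/
  edges : ℕ → SimpleGraph (KRWord N)
  /-- Edges join vertices. -/
  mem_of_adj : ∀ i x y, (edges i).Adj x y → x ∈ verts ∧ y ∈ verts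
  /-- The colors of the edges are among `2, 3, …, n - 1`. -/
  color_mem : ∀ i x y, (edges i).Adj x y → 2 ≤ i ∧ i + 1 ≤ n
  /-- For each KR square, exactly one of the six possibilities occurs. -/
  existsUnique_possibility : ∀ (v w : KRWord N) (a b c : Fin N), a < b → b < c →
    (insertTriple v w a b c).Nodup →
      ∃! p : KRPossibility, p.Occurs (verts : Set (KRWord N)) (edges (v.length + 2)) v w a b c

/-- A partial D₀ graph is a D₀ graph if no KR square is undetermined. -/
def PartialD0Graph.IsD0Graph {N n : ℕ} (H : PartialD0Graph N n) : Prop :=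
  ∀ (v w : KRWord N) (a b c : Fin N), a < b → b < c → (insertTriple v w a b c).Nodup →
    ¬ KRPossibility.undetermined.Occurs (H.verts : Set (KRWord N)) (H.edges (v.length + 2))
      v w a b c

/-- The sum of the vertices of `H` in the free associative algebra. -/
def PartialD0Graph.vertexSum {N n : ℕ} (H : PartialD0Graph N n) : FreeAlg N :=
  ∑ w ∈ H.verts, wordMonomial w

/-- The generating function `∑_{w ∈ V(H)} Q_{Des(w)}(x)` of `H`. -/
def PartialD0Graph.generatingFunction {N n : ℕ} (H : PartialD0Graph N n) : MvPowerSeries ℕ ℤ :=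
  ∑ w ∈ H.verts, fundamentalQuasisymmetric n (descentSet w)

end

/-!
Call `γ` balanced if it involves no word with a repeated letter and its coefficients on the two
diagonals of every KR square have the same sum; in each of the six possibilities for a KR square
this holds for the sum `γ` of the vertices. The letters modulo the largest two-sided ideal
orthogonal to `γ` then satisfy `u_a x u_a = 0` and `[u_b, [u_a, u_c]] = 0` for `a < b < c`, and
these relations suffice for the noncommutative elementary functions `e_k(u)` to commute. So they
generate a commutative ring, which contains the complete functions `h_k(u)` as well, and in which
`𝔍_μ(u)` is the Jacobi–Trudi determinant, whence `∏ h_{m_i}(u) = ∑_μ K_{μ m} 𝔍_μ(u)`.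

As `γ` involves only words without repeated letters, the coefficient of `x^m` in its generating
function is the pairing of `γ` with `∏ h_{m_i}(u)`. The formula above expands it in Schur
functions, and its symmetry is the commutativity of the `h_k(u)`. The expansion is unique since the
matrix of the Kostka numbers is unitriangular.
-/

/-! ### Noncommutative elementary and complete symmetric functions -/

section ElementaryComplete

variable {A α : Type*} [Ring A]

/-- Two sequences `e` and `h` in a ring behave like the elementary and the complete homogeneous
symmetric functions: the generating series `∑ (-1)ⁱ hᵢ tⁱ` is a left inverse of `∑ eᵢ tⁱ`. -/
structure IsElementaryCompletePair (e h : ℕ → A) : Prop where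
  e_zero : e 0 = 1
  h_zero : h 0 = 1
  sum_eq_zero (k : ℕ) :
    ∑ p ∈ Finset.HasAntidiagonal.antidiagonal (k + 1), (-1) ^ p.1 * (h p.1 * e p.2) = 0

/-- The elementary symmetric function of degree `k` in the noncommuting elements `u a` for `a`
in a list: the sum of the products `u a₁ * ⋯ * u a_k` over the sublists `[a₁, …, a_k]`. -/
def listElementary (u : α → A) : List α → ℕ → A
  | _, 0 => 1
  | [], _ + 1 => 0
  | a :: l, k + 1 => listElementary u l (k + 1) + u a * listElementary u l k

/-- The complete symmetric function of degree `k` in the noncommuting elements `u a`, restricted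
to products with distinct factors: the sum of the products `u a_k * ⋯ * u a₁`, in the order
opposite to that of `listElementary`, over the sublists `[a₁, …, a_k]`. The omitted products
vanish under the relations of `SatisfiesKR`. -/
def listComplete (u : α → A) : List α → ℕ → A
  | _, 0 => 1
  | [], _ + 1 => 0
  | a :: l, k + 1 => listComplete u l (k + 1) + listComplete u l k * u a

@[simp] theorem listElementary_zero (u : α → A) (l : List α) : listElementary u l 0 = 1 := by
  cases l <;> rfl

@[simp] theorem listComplete_zero (u : α → A) (l : List α) : listComplete u l 0 = 1 := by
  cases l <;> rfl

theorem listElementary_cons_succ (u : α → A) (a : α) (l : List α) (k : ℕ) :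
    listElementary u (a :: l) (k + 1) = listElementary u l (k + 1) + u a * listElementary u l k :=
  rfl

theorem listComplete_cons_succ (u : α → A) (a : α) (l : List α) (k : ℕ) :
    listComplete u (a :: l) (k + 1) = listComplete u l (k + 1) + listComplete u l k * u a :=
  rfl

theorem map_listElementary {B : Type*} [Ring B] (f : A →+* B) (u : α → A) (l : List α) (k : ℕ) :
    f (listElementary u l k) = listElementary (fun a => f (u a)) l k := by
  induction l generalizing k with
  | nil => cases k <;> simp [listElementary]
  | cons a l ih => cases k <;> simp [listElementary_cons_succ, ih]

theorem map_listComplete {B : Type*} [Ring B] (f : A →+* B) (u : α → A) (l : List α) (k : ℕ) :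
    f (listComplete u l k) = listComplete (fun a => f (u a)) l k := by
  induction l generalizing k with
  | nil => cases k <;> simp [listComplete]
  | cons a l ih => cases k <;> simp [listComplete_cons_succ, ih]

open PowerSeries in
theorem mk_listElementary_cons (u : α → A) (a : α) (l : List α) :
    mk (listElementary u (a :: l)) = (1 + C (u a) * X) * mk (listElementary u l) := by
  ext i
  cases i with
  | zero => simp [add_mul, mul_assoc]
  | succ i => simp [add_mul, mul_assoc, coeff_succ_X_mul, listElementary_cons_succ]

open PowerSeries in
theorem mk_listComplete_cons (u : α → A) (a : α) (l : List α) :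
    mk (fun i => (-1) ^ i * listComplete u (a :: l) i) =
      mk (fun i => (-1) ^ i * listComplete u l i) * (1 - C (u a) * X) := by
  ext i
  cases i with
  | zero => simp [mul_sub, ← mul_assoc]
  | succ i =>
    simp [← mul_assoc, coeff_succ_mul_X, listComplete_cons_succ, pow_succ, mul_add,
      sub_eq_add_neg]

open PowerSeries in
theorem mk_listComplete_mul_mk_listElementary {u : α → A} (hu : ∀ a, u a * u a = 0)
    (l : List α) :
    mk (fun i => (-1) ^ i * listComplete u l i) * mk (listElementary u l) = 1 := by
  induction l with
  | nil =>
    have hc : mk (fun i => (-1 : A) ^ i * listComplete u [] i) = 1 := by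
      ext i; cases i <;> simp [listComplete, coeff_one]
    have he : mk (listElementary u []) = 1 := by
      ext i; cases i <;> simp [listElementary, coeff_one]
    rw [hc, he, mul_one]
  | cons a l ih =>
    have hsq : (C (u a) * X : A⟦X⟧) * (C (u a) * X) = 0 := by
      rw [mul_assoc, ← mul_assoc X, X_mul, mul_assoc, ← mul_assoc, ← map_mul, hu, map_zero,
        zero_mul]
    have hinv : (1 - C (u a) * X) * (1 + C (u a) * X) = (1 : A⟦X⟧) := by
      rw [sub_mul, mul_add, mul_add, hsq]
      simp
    rw [mk_listComplete_cons, mk_listElementary_cons, mul_assoc, ← mul_assoc (1 - _), hinv,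
      one_mul, ih]

theorem isElementaryCompletePair_list {u : α → A} (hu : ∀ a, u a * u a = 0) (l : List α) :
    IsElementaryCompletePair (listElementary u l) (listComplete u l) where
  e_zero := listElementary_zero u l
  h_zero := listComplete_zero u l
  sum_eq_zero k := by
    have := congrArg (PowerSeries.coeff (k + 1)) (mk_listComplete_mul_mk_listElementary hu l)
    simpa [PowerSeries.coeff_mul, PowerSeries.coeff_one, mul_assoc] using this

end ElementaryComplete

section KRRelations

variable {A α : Type*} [Ring A]

/-- The elements `u a` satisfy the KR (Knuth and rotation) relations: a product with a repeated
factor `u a` vanishes, and `u b` commutes with `⁅u a, u c⁆` for `a < b < c`. The latter says that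
`bac + cab = bca + acb`. -/
structure SatisfiesKR [LT α] (u : α → A) : Prop where
  mul_mul_self (a : α) (x : A) : u a * x * u a = 0
  commute_lie {a b c : α} : a < b → b < c → Commute (u b) ⁅u a, u c⁆

theorem SatisfiesKR.mul_self [LT α] {u : α → A} (hu : SatisfiesKR u) (a : α) :
    u a * u a = 0 := by
  simpa using hu.mul_mul_self a 1

theorem SatisfiesKR.lie_mul_mul_left [LT α] {u : α → A} (hu : SatisfiesKR u) (b c : α) (x : A) :
    ⁅u b, u c⁆ * x * u b = 0 := by
  rw [Ring.lie_def, sub_mul, sub_mul, mul_assoc (u b), hu.mul_mul_self, mul_assoc (u c),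
    mul_assoc (u c), hu.mul_mul_self, mul_zero, sub_zero]

theorem mul_listElementary_erase [DecidableEq α] {u : α → A} {b : α} {x : A}
    (hx : ∀ y, x * y * u b = 0) (l : List α) (k : ℕ) :
    x * listElementary u (l.erase b) k = x * listElementary u l k := by
  induction l generalizing k x with
  | nil => rfl
  | cons a l ih =>
    cases k with
    | zero => simp
    | succ k =>
      by_cases hab : a = b
      · subst hab
        have hxa : x * u a = 0 := by simpa using hx 1
        rw [List.erase_cons_head, listElementary_cons_succ, mul_add, ← mul_assoc, hxa, zero_mul,
          add_zero]
      · rw [List.erase_cons_tail (by simpa using hab), listElementary_cons_succ,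
          listElementary_cons_succ, mul_add, mul_add, ih hx, ← mul_assoc, ← mul_assoc,
          ih fun y => by rw [mul_assoc x, hx]]

variable [LinearOrder α] {u : α → A}

theorem SatisfiesKR.lie_listElementary (hu : SatisfiesKR u) {c : α} {l : List α}
    (hl : (c :: l).Pairwise (· > ·)) (k : ℕ) :
    ⁅listElementary u l (k + 1), u c⁆ =
      (l.map fun b => ⁅u b, u c⁆ * listElementary u (l.erase b) k).sum := by
  induction l generalizing k with
  | nil => simp [Ring.lie_def, listElementary]
  | cons a l ih =>
    obtain ⟨hc, hal⟩ := List.pairwise_cons.1 hl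
    have hca : a < c := hc a (by simp)
    have hla : ∀ b ∈ l, b < a := (List.pairwise_cons.1 hal).1
    have hcl : (c :: l).Pairwise (· > ·) := hl.sublist (by simp)
    have erase_cons : ∀ b ∈ l, (a :: l).erase b = a :: l.erase b := fun b hb =>
      List.erase_cons_tail (by simpa using (hla b hb).ne')
    have hlie : ⁅listElementary u (a :: l) (k + 1), u c⁆ = ⁅u a, u c⁆ * listElementary u l k +
        (⁅listElementary u l (k + 1), u c⁆ + u a * ⁅listElementary u l k, u c⁆) := by
      simp only [listElementary_cons_succ, Ring.lie_def]
      noncomm_ring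
    rw [List.map_cons, List.sum_cons, List.erase_cons_head, hlie, ih hcl]
    congr 1
    cases k with
    | zero =>
      simp only [listElementary_zero, Ring.lie_def, one_mul, mul_one, sub_self, mul_zero, add_zero]
    | succ k =>
      rw [ih hcl, ← List.sum_map_mul_left, ← List.sum_map_add]
      congr 1
      refine List.map_congr_left fun b hb => ?_
      rw [erase_cons b hb, listElementary_cons_succ, mul_add, ← mul_assoc, ← mul_assoc,
        (hu.commute_lie (hla b hb) hca).eq]

/-- In the sum for the commutator with `u c`, each term starts with a factor that kills every
later `u b`, so that both sides may be computed without the letter `b`. -/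
theorem SatisfiesKR.lie_listElementary_mul_comm (hu : SatisfiesKR u) {c : α} {l : List α}
    (hl : (c :: l).Pairwise (· > ·)) {j k : ℕ}
    (hcomm : ∀ b ∈ l, Commute (listElementary u (l.erase b) j) (listElementary u (l.erase b) k)) :
    ⁅listElementary u l (j + 1), u c⁆ * listElementary u l k =
      ⁅listElementary u l (k + 1), u c⁆ * listElementary u l j := by
  rw [hu.lie_listElementary hl, hu.lie_listElementary hl, ← List.sum_map_mul_right,
    ← List.sum_map_mul_right]
  congr 1
  refine List.map_congr_left fun b hb => ?_
  have hkill : ∀ i y, ⁅u b, u c⁆ * listElementary u (l.erase b) i * y * u b = 0 := fun i y => by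
    rw [mul_assoc _ _ y, hu.lie_mul_mul_left]
  rw [← mul_listElementary_erase (hkill j) l k, ← mul_listElementary_erase (hkill k) l j,
    mul_assoc, mul_assoc, (hcomm b hb).eq]

theorem SatisfiesKR.commute_listElementary (hu : SatisfiesKR u) {l : List α}
    (hl : l.Pairwise (· > ·)) (j k : ℕ) :
    Commute (listElementary u l j) (listElementary u l k) := by
  induction hn : l.length using Nat.strong_induction_on generalizing l j k with
  | _ n ih =>
    match l, j, k with
    | _, 0, _ => simp
    | _, _, 0 => simp
    | [], _ + 1, _ + 1 => simp [listElementary]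
    | c :: l, j + 1, k + 1 =>
      have hl' := (List.pairwise_cons.1 hl).2
      have hlen : l.length < n := by simp at hn; omega
      have hcomm : ∀ i m, Commute (listElementary u l i) (listElementary u l m) := fun i m =>
        ih _ hlen hl' i m rfl
      have herase : ∀ b ∈ l,
          Commute (listElementary u (l.erase b) j) (listElementary u (l.erase b) k) := fun b _ =>
        ih _ (List.erase_sublist.length_le.trans_lt hlen) (hl'.sublist List.erase_sublist) j k rfl
      have hlie := hu.lie_listElementary_mul_comm hl herase
      have h₁ := (hcomm (j + 1) (k + 1)).eq
      have h₂ := (hcomm j (k + 1)).eq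
      have h₃ := (hcomm k (j + 1)).eq
      rw [commute_iff_eq, listElementary_cons_succ, listElementary_cons_succ]
      generalize listElementary u l (j + 1) = J at *
      generalize listElementary u l (k + 1) = K at *
      generalize listElementary u l j = J' at *
      generalize listElementary u l k = K' at *
      have hexpand : (J + u c * J') * (K + u c * K') - (K + u c * K') * (J + u c * J') =
          (J * K - K * J) + (⁅J, u c⁆ * K' - ⁅K, u c⁆ * J') + u c * (J' * K - K * J') -
            u c * (K' * J - J * K') + (u c * J' * u c * K' - u c * K' * u c * J') := by
        simp only [Ring.lie_def]
        noncomm_ring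
      rw [← sub_eq_zero, hexpand, hlie, h₁, h₂, h₃, hu.mul_mul_self, hu.mul_mul_self]
      simp only [sub_self, mul_zero, zero_mul, add_zero]

end KRRelations

/-! ### Jacobi–Trudi determinants and the Pieri rule -/

section ExtendByZero

variable {A : Type*}

/-- The extension of a sequence to the integers by zero, as in the convention `e_d = 0` for
`d < 0`. -/
def extendByZero [Zero A] (e : ℕ → A) (d : ℤ) : A := if 0 ≤ d then e d.toNat else 0

@[simp] theorem extendByZero_natCast [Zero A] (e : ℕ → A) (d : ℕ) : extendByZero e d = e d := by
  simp [extendByZero]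

theorem extendByZero_of_neg [Zero A] (e : ℕ → A) {d : ℤ} (hd : d < 0) : extendByZero e d = 0 := by
  simp [extendByZero, hd]

open Finset in
theorem IsElementaryCompletePair.sum_range_mul_extendByZero [Ring A] {e h : ℕ → A}
    (hp : IsElementaryCompletePair e h) {n : ℕ} {d : ℤ} (hd : d < n) :
    ∑ i ∈ range n, (-1) ^ i * h i * extendByZero e (d - i) = if d = 0 then 1 else 0 := by
  rcases lt_or_ge d 0 with hneg | hnonneg
  · rw [if_neg hneg.ne]
    exact Finset.sum_eq_zero fun i _ => by rw [extendByZero_of_neg e (by omega), mul_zero]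
  lift d to ℕ using hnonneg
  rw [← sum_subset (range_subset_range.2 (show d + 1 ≤ n by omega)) fun i _ hi => by
    rw [extendByZero_of_neg e (by rw [mem_range] at hi; omega), mul_zero]]
  calc ∑ i ∈ range (d + 1), (-1) ^ i * h i * extendByZero e (d - i)
      = ∑ i ∈ range (d + 1), (-1) ^ i * (h i * e (d - i)) :=
        sum_congr rfl fun i hi => by
          rw [← Nat.cast_sub (mem_range_succ_iff.1 hi), extendByZero_natCast, mul_assoc]
    _ = ∑ p ∈ HasAntidiagonal.antidiagonal d, (-1) ^ p.1 * (h p.1 * e p.2) :=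
        (Nat.sum_antidiagonal_eq_sum_range_succ
          (fun i j => (-1) ^ i * (h i * e j)) d).symm
    _ = _ := by
      cases d with
      | zero => simp [hp.e_zero, hp.h_zero]
      | succ d => rw [hp.sum_eq_zero, if_neg (by positivity)]

end ExtendByZero

section ColumnShift

open Finset

variable {A : Type*} [CommRing A]

theorem sum_det_rowShift_eq_sum_det_colShift {n : ℕ} (M : Matrix (Fin n) (Fin (n + 1)) A) (k : ℕ) :
    ∑ S ∈ powersetCard k (univ : Finset (Fin n)),
        (Matrix.of fun i j : Fin n => M i (if i ∈ S then j.succ else j.castSucc)).det =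
      ∑ S ∈ powersetCard k (univ : Finset (Fin n)),
        (Matrix.of fun i j : Fin n => M i (if j ∈ S then j.succ else j.castSucc)).det := by
  simp only [Matrix.det_apply, Matrix.of_apply]
  rw [sum_comm, sum_comm (s := powersetCard k univ)]
  refine sum_congr rfl fun σ _ => ?_
  refine sum_nbij' (fun S => S.map σ.symm.toEmbedding) (fun S => S.map σ.toEmbedding) ?_ ?_ ?_ ?_ ?_
  · simp [mem_powersetCard]
  · simp [mem_powersetCard]
  · intro S _; ext; simp
  · intro S _; ext; simp
  · intro S _; simp

theorem exists_mem_succ_notMem_of_not_isUpperSet {n : ℕ} {S : Finset (Fin n)}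
    (hS : ¬ IsUpperSet (S : Set (Fin n))) :
    ∃ (j : ℕ) (hj : j + 1 < n), (⟨j, by omega⟩ : Fin n) ∈ S ∧ (⟨j + 1, hj⟩ : Fin n) ∉ S := by
  contrapose! hS
  intro a b hab ha
  have hup : ∀ j : ℕ, (a : ℕ) ≤ j → ∀ hj : j < n, (⟨j, hj⟩ : Fin n) ∈ S := by
    intro j haj
    induction j, haj using Nat.le_induction with
    | base => exact fun _ => ha
    | succ j _ ih => exact fun hj => hS j hj (ih (by omega))
  exact hup b hab b.2

theorem mem_iff_of_isUpperSet_of_card_eq {m k : ℕ} {S : Finset (Fin (m + k))}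
    (hS : IsUpperSet (S : Set (Fin (m + k)))) (hcard : #S = k) (j : Fin (m + k)) :
    j ∈ S ↔ m ≤ (j : ℕ) := by
  constructor
  · intro hj
    have := card_le_card (show Ici j ⊆ S from fun x hx => hS (mem_Ici.1 hx) hj)
    rw [Fin.card_Ici] at this
    omega
  · intro hmj
    by_contra hj
    have := card_le_card (show S ⊆ Ioi j from fun x hx => mem_Ioi.2 <| lt_of_not_ge fun hxj =>
      hj (hS hxj hx))
    rw [Fin.card_Ioi] at this
    omega

/-- Exchanging the roles of rows and columns, every summand in which some column is shifted but
the next one is not has two equal columns. -/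
theorem sum_det_rowShift {m k : ℕ} (M : Matrix (Fin (m + k)) (Fin (m + k + 1)) A) :
    ∑ S ∈ powersetCard k (univ : Finset (Fin (m + k))),
        (Matrix.of fun i j => M i (if i ∈ S then j.succ else j.castSucc)).det =
      (M.submatrix id (Fin.succAbove ⟨m, by omega⟩)).det := by
  rw [sum_det_rowShift_eq_sum_det_colShift]
  let S₀ : Finset (Fin (m + k)) := univ.filter fun j => m ≤ (j : ℕ)
  have hS₀ : #S₀ = k := by
    have : S₀ = univ.map (Fin.natAddEmb m) := by
      ext j
      simp only [S₀, mem_filter, mem_univ, true_and, mem_map, Fin.natAddEmb_apply]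
      exact ⟨fun hj => ⟨⟨j - m, by omega⟩, Fin.ext (by simp; omega)⟩,
        by rintro ⟨i, rfl⟩; simp⟩
    rw [this, card_map, card_univ, Fintype.card_fin]
  rw [sum_eq_single_of_mem S₀ (mem_powersetCard.2 ⟨subset_univ _, hS₀⟩)]
  · congr 1
    ext i j
    by_cases hj : m ≤ (j : ℕ)
    · simp [S₀, hj, Fin.succAbove, Fin.lt_def, not_lt.2 hj]
    · simp [S₀, hj, Fin.succAbove, Fin.lt_def, not_le.1 hj]
  · intro S hS hne
    have hupper : ¬ IsUpperSet (S : Set (Fin (m + k))) := fun hupper => hne <| by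
      ext j
      simp [S₀, mem_iff_of_isUpperSet_of_card_eq hupper (mem_powersetCard.1 hS).2]
    obtain ⟨j, hj, hmem, hnotMem⟩ := exists_mem_succ_notMem_of_not_isUpperSet hupper
    refine Matrix.det_zero_of_column_eq (i := ⟨j, by omega⟩) (j := ⟨j + 1, hj⟩) (by simp)
      fun i => ?_
    simp [hmem, hnotMem]

end ColumnShift

section JacobiTrudi

open Finset

variable {A : Type*} [CommRing A]

/-- The dual Jacobi–Trudi matrix `(e_{c_i + j - i})` of size `n`, where `c` is the sequence of
column lengths of a partition. -/
def jacobiTrudiMatrix (e : ℕ → A) (n : ℕ) (c : ℕ → ℕ) : Matrix (Fin n) (Fin n) A :=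
  Matrix.of fun i j => extendByZero e ((c i : ℤ) + (j : ℕ) - (i : ℕ))

/-- The dual Jacobi–Trudi determinant `det (e_{c_i + j - i})` of size `n`. -/
def jacobiTrudi (e : ℕ → A) (n : ℕ) (c : ℕ → ℕ) : A := (jacobiTrudiMatrix e n c).det

theorem jacobiTrudiMatrix_apply_of_eq_zero (e : ℕ → A) {n : ℕ} {c : ℕ → ℕ} {i : Fin n}
    (hi : c i = 0) (j : Fin n) :
    jacobiTrudiMatrix e n c i j = extendByZero e ((j : ℕ) - (i : ℕ)) := by
  rw [jacobiTrudiMatrix, Matrix.of_apply, hi, Nat.cast_zero, zero_add]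

theorem jacobiTrudi_succ {e : ℕ → A} (he : e 0 = 1) (n : ℕ) {c : ℕ → ℕ} (hc : c n = 0) :
    jacobiTrudi e (n + 1) c = jacobiTrudi e n c := by
  have hlast : jacobiTrudiMatrix e (n + 1) c (Fin.last n) = Pi.single (Fin.last n) 1 := by
    ext j
    rw [jacobiTrudiMatrix_apply_of_eq_zero e (by simpa using hc), Pi.single_apply]
    split_ifs with hj
    · simpa [hj, he] using extendByZero_natCast e 0
    · exact extendByZero_of_neg e (by have := Fin.val_lt_last hj; simp; omega)
  rw [jacobiTrudi, Matrix.det_succ_row _ (Fin.last n), sum_eq_single (Fin.last n)]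
  · rw [hlast, Pi.single_eq_same, mul_one, Even.neg_one_pow ⟨_, rfl⟩, one_mul, jacobiTrudi]
    congr 1
    ext i j
    simp [jacobiTrudiMatrix, Fin.succAbove_last]
  · intro j _ hj
    simp [hlast, hj]
  · simp

theorem jacobiTrudi_eq_of_le {e : ℕ → A} (he : e 0 = 1) {m n : ℕ} (hmn : m ≤ n) {c : ℕ → ℕ}
    (hc : ∀ i, m ≤ i → c i = 0) : jacobiTrudi e n c = jacobiTrudi e m c := by
  induction n, hmn using Nat.le_induction with
  | base => rfl
  | succ n hn ih => rw [jacobiTrudi_succ he n (hc n hn), ih]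

theorem jacobiTrudi_eq_zero_of_succ_eq (e : ℕ → A) {n i : ℕ} {c : ℕ → ℕ} (hi : i + 1 < n)
    (hc : c (i + 1) = c i + 1) : jacobiTrudi e n c = 0 := by
  refine Matrix.det_zero_of_row_eq (i := ⟨i, by omega⟩) (j := ⟨i + 1, hi⟩) (by simp) ?_
  ext j
  simp only [jacobiTrudiMatrix, Matrix.of_apply, hc]
  congr 1
  push_cast
  ring

theorem IsElementaryCompletePair.sum_smul_jacobiTrudiMatrix {e h : ℕ → A}
    (hp : IsElementaryCompletePair e h) {m k : ℕ} {c : ℕ → ℕ} (hc : ∀ i, m ≤ i → c i = 0) :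
    ∑ i : Fin (k + 1), ((-1) ^ (i : ℕ) * h i) •
        jacobiTrudiMatrix e (m + (k + 1)) c (Fin.natAdd m i) =
      Pi.single (Fin.natAdd m 0) 1 := by
  ext j
  have hrow : ∀ i : Fin (k + 1), jacobiTrudiMatrix e (m + (k + 1)) c (Fin.natAdd m i) j =
      extendByZero e ((j : ℕ) - (m : ℕ) - (i : ℕ)) := fun i => by
    rw [jacobiTrudiMatrix_apply_of_eq_zero e (hc _ (by simp)), Fin.val_natAdd, Nat.cast_add,
      sub_sub]
  simp only [Finset.sum_apply, Pi.smul_apply, smul_eq_mul, hrow]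
  rw [Fin.sum_univ_eq_sum_range fun i => (-1) ^ i * h i * extendByZero e ((j : ℕ) - (m : ℕ) - i),
    hp.sum_range_mul_extendByZero (by omega), Pi.single_apply]
  exact if_congr (by rw [Fin.ext_iff]; simp; omega) rfl rfl

/-- The last row may be replaced by the combination of the last `k + 1` rows with coefficients
`(-1)ⁱ hᵢ`, at the cost of a factor `(-1)ᵏ hₖ`; that combination is a unit vector. -/
theorem IsElementaryCompletePair.mul_jacobiTrudi_eq_det_submatrix {e h : ℕ → A}
    (hp : IsElementaryCompletePair e h) {m k : ℕ} {c : ℕ → ℕ} (hc : ∀ i, m ≤ i → c i = 0) :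
    h k * jacobiTrudi e (m + k + 1) c =
      ((jacobiTrudiMatrix e (m + k + 1) c).submatrix Fin.castSucc
        (Fin.succAbove ⟨m, by omega⟩)).det := by
  set B := jacobiTrudiMatrix e (m + k + 1) c
  let p : Fin (m + k + 1) := ⟨m, by omega⟩
  let coeffs : Fin (m + k + 1) → A :=
    Fin.addCases (m := m) (n := k + 1) (fun _ => 0) fun i => (-1) ^ (i : ℕ) * h i
  have hsum : ∑ q, coeffs q • B q = Pi.single p 1 := by
    refine (Fin.sum_univ_add (a := m) (b := k + 1) _).trans ?_
    simp only [coeffs, Fin.addCases_left, Fin.addCases_right, zero_smul, sum_const_zero, zero_add]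
    exact hp.sum_smul_jacobiTrudiMatrix hc
  have hlast : coeffs (Fin.last (m + k)) = (-1) ^ k * h k :=
    Fin.addCases_right (motive := fun _ => A) (Fin.last k)
  have hupdate : (B.updateRow (Fin.last (m + k)) (Pi.single p 1)).det =
      (-1) ^ (m + k + m) * (B.submatrix Fin.castSucc p.succAbove).det := by
    rw [Matrix.det_succ_row _ (Fin.last (m + k)), sum_eq_single p]
    · have : (B.updateRow (Fin.last (m + k)) (Pi.single p 1)).submatrix
          (Fin.last (m + k)).succAbove p.succAbove = B.submatrix Fin.castSucc p.succAbove := by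
        ext i j
        simp [Fin.succAbove_last, Matrix.updateRow_apply, (Fin.castSucc_lt_last i).ne]
      rw [this, Matrix.updateRow_self, Pi.single_eq_same, mul_one, Fin.val_last]
    · intro j _ hj
      simp [Matrix.updateRow_self, hj]
    · simp
  have hdet := Matrix.det_updateRow_sum B (Fin.last (m + k)) coeffs
  rw [hsum, hupdate, hlast, smul_eq_mul, show m + k + m = k + 2 * m by ring, pow_add, pow_mul,
    neg_one_sq, one_pow, mul_one, mul_assoc] at hdet
  exact (((isUnit_neg_one (α := A)).pow k).mul_left_cancel hdet).symm

theorem IsElementaryCompletePair.mul_jacobiTrudi {e h : ℕ → A}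
    (hp : IsElementaryCompletePair e h) {m k : ℕ} {c : ℕ → ℕ} (hc : ∀ i, m ≤ i → c i = 0) :
    h k * jacobiTrudi e (m + k) c =
      ∑ S ∈ powersetCard k (range (m + k)),
        jacobiTrudi e (m + k) fun i => c i + if i ∈ S then 1 else 0 := by
  have hrange : range (m + k) = (univ : Finset (Fin (m + k))).map Fin.valEmbedding := by
    rw [Fin.map_valEmbedding_univ, Nat.Iio_eq_range]
  rw [← jacobiTrudi_succ hp.e_zero _ (hc _ (Nat.le_add_right m k)),
    hp.mul_jacobiTrudi_eq_det_submatrix hc, hrange, powersetCard_map, sum_map]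
  have hshift := sum_det_rowShift ((jacobiTrudiMatrix e (m + k + 1) c).submatrix Fin.castSucc id)
  rw [Matrix.submatrix_submatrix, Function.comp_id, Function.id_comp] at hshift
  rw [← hshift]
  refine sum_congr rfl fun S _ => ?_
  rw [jacobiTrudi]
  congr 1
  ext i j
  have hi : (i : ℕ) ∈ (mapEmbedding Fin.valEmbedding).toEmbedding S ↔ i ∈ S :=
    mem_map' Fin.valEmbedding
  simp only [jacobiTrudiMatrix, Matrix.of_apply, Matrix.submatrix_apply, id, Fin.val_castSucc, hi]
  congr 1
  split_ifs
  · push_cast [Fin.val_succ]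
    ring
  · simp

end JacobiTrudi

section Young

variable {μ ν : YoungDiagram}

theorem le_iff_colLen_le : μ ≤ ν ↔ ∀ j, μ.colLen j ≤ ν.colLen j := by
  refine ⟨fun h j => ?_, fun h ⟨i, j⟩ hc => ?_⟩
  · by_contra! hlt
    exact (YoungDiagram.mem_iff_lt_colLen.1 (h (YoungDiagram.mem_iff_lt_colLen.2 hlt))).false
  · exact YoungDiagram.mem_iff_lt_colLen.2 ((YoungDiagram.mem_iff_lt_colLen.1 hc).trans_le (h j))

theorem eq_of_colLen_eq (h : ∀ j, μ.colLen j = ν.colLen j) : μ = ν :=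
  le_antisymm (le_iff_colLen_le.2 fun j => (h j).le) (le_iff_colLen_le.2 fun j => (h j).ge)

theorem rowLen_zero_le_iff {n : ℕ} : μ.rowLen 0 ≤ n ↔ μ.colLen n = 0 := by
  rw [← not_lt, ← YoungDiagram.mem_iff_lt_rowLen, YoungDiagram.mem_iff_lt_colLen, not_lt,
    Nat.le_zero]

theorem colLen_eq_zero_of_rowLen_le {j : ℕ} (h : μ.rowLen 0 ≤ j) : μ.colLen j = 0 :=
  rowLen_zero_le_iff.1 h

theorem exists_colLen_eq {c : ℕ → ℕ} (hc : Antitone c) {n : ℕ} (hn : c n = 0) :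
    ∃ μ : YoungDiagram, ∀ j, μ.colLen j = c j := by
  let μ : YoungDiagram :=
    { cells := (Finset.range (c 0) ×ˢ Finset.range n).filter fun x => x.1 < c x.2
      isLowerSet := by
        rintro ⟨i, j⟩ ⟨i', j'⟩ ⟨hi, hj⟩ h
        simp only [Finset.coe_filter, Finset.mem_product, Finset.mem_range,
          Set.mem_ofPred_eq] at h hi hj ⊢
        have := hc hj
        omega }
  have hμ : ∀ i j, (i, j) ∈ μ ↔ i < c j := by
    intro i j
    rw [← YoungDiagram.mem_cells]
    simp only [μ, Finset.mem_filter, Finset.mem_product, Finset.mem_range]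
    refine ⟨And.right, fun h => ⟨⟨h.trans_le (hc (Nat.zero_le j)), ?_⟩, h⟩⟩
    by_contra! hnj
    have := hc hnj
    omega
  exact ⟨μ, fun j => eq_of_forall_lt_iff fun i => by rw [← YoungDiagram.mem_iff_lt_colLen, hμ]⟩

theorem card_eq_sum_colLen {n : ℕ} (hn : μ.rowLen 0 ≤ n) :
    μ.card = ∑ j ∈ Finset.range n, μ.colLen j := by
  have hmem : ∀ x ∈ μ.cells, x.2 ∈ Finset.range n := by
    rintro ⟨i, j⟩ hx
    have := YoungDiagram.mem_iff_lt_rowLen.1 (μ.mem_cells _ |>.1 hx)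
    exact Finset.mem_range.2 (this.trans_le ((μ.rowLen_anti 0 i (Nat.zero_le i)).trans hn))
  rw [YoungDiagram.card, Finset.card_eq_sum_card_fiberwise hmem]
  exact Finset.sum_congr rfl fun j _ => μ.colLen_eq_card.symm

theorem rowLen_zero_le_card (μ : YoungDiagram) : μ.rowLen 0 ≤ μ.card := by
  rw [YoungDiagram.rowLen_eq_card]
  exact Finset.card_le_card (Finset.filter_subset _ _)

theorem colLen_zero_le_card (μ : YoungDiagram) : μ.colLen 0 ≤ μ.card := by
  rw [YoungDiagram.colLen_eq_card]
  exact Finset.card_le_card (Finset.filter_subset _ _)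

theorem fst_lt_card_of_mem {i j : ℕ} (h : (i, j) ∈ μ) : i < μ.card :=
  (YoungDiagram.mem_iff_lt_colLen.1 h).trans_le
    ((μ.colLen_anti 0 j (Nat.zero_le j)).trans (colLen_zero_le_card μ))

theorem snd_lt_card_of_mem {i j : ℕ} (h : (i, j) ∈ μ) : j < μ.card :=
  (YoungDiagram.mem_iff_lt_rowLen.1 h).trans_le
    ((μ.rowLen_anti 0 i (Nat.zero_le i)).trans (rowLen_zero_le_card μ))

theorem finite_setOf_card_eq (n : ℕ) : {μ : YoungDiagram | μ.card = n}.Finite := by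
  refine Set.Finite.of_finite_image (f := YoungDiagram.cells) ?_
    fun μ _ ν _ h => YoungDiagram.ext h
  refine (Finset.range n ×ˢ Finset.range n).powerset.finite_toSet.subset ?_
  rintro _ ⟨μ, rfl, rfl⟩
  rw [Finset.mem_coe, Finset.mem_powerset]
  rintro ⟨i, j⟩ hx
  rw [YoungDiagram.mem_cells] at hx
  exact Finset.mem_product.2
    ⟨Finset.mem_range.2 (fst_lt_card_of_mem hx), Finset.mem_range.2 (snd_lt_card_of_mem hx)⟩

/-- The finite set of Young diagrams with `n` cells, that is, of partitions of `n`. -/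
noncomputable def youngDiagramsOfCard (n : ℕ) : Finset YoungDiagram :=
  (finite_setOf_card_eq n).toFinset

@[simp] theorem mem_youngDiagramsOfCard {n : ℕ} : μ ∈ youngDiagramsOfCard n ↔ μ.card = n := by
  simp [youngDiagramsOfCard]

/-- The skew diagram `ν / μ` is a horizontal strip: `μ` is contained in `ν`, and no column
contains two cells of the difference. -/
structure IsHorizontalStrip (μ ν : YoungDiagram) : Prop where
  le : μ ≤ ν
  colLen_le_succ (j : ℕ) : ν.colLen j ≤ μ.colLen j + 1

/-- The columns in which `ν` is longer than `μ`. They determine `ν` when `ν / μ` is a horizontal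
strip. -/
def stripColumns (μ ν : YoungDiagram) : Finset ℕ :=
  (Finset.range (ν.rowLen 0)).filter fun j => μ.colLen j < ν.colLen j

theorem mem_stripColumns {j : ℕ} : j ∈ stripColumns μ ν ↔ μ.colLen j < ν.colLen j := by
  rw [stripColumns, Finset.mem_filter, Finset.mem_range, and_iff_right_iff_imp]
  intro h
  by_contra! hj
  rw [colLen_eq_zero_of_rowLen_le hj] at h
  omega

theorem stripColumns_subset {n : ℕ} (hn : ν.rowLen 0 ≤ n) :
    stripColumns μ ν ⊆ Finset.range n :=
  (Finset.filter_subset _ _).trans (Finset.range_subset_range.2 hn)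

theorem IsHorizontalStrip.colLen_eq (h : IsHorizontalStrip μ ν) (j : ℕ) :
    ν.colLen j = μ.colLen j + if j ∈ stripColumns μ ν then 1 else 0 := by
  have hle := le_iff_colLen_le.1 h.le j
  have hsucc := h.colLen_le_succ j
  split_ifs with hj <;> rw [mem_stripColumns] at hj <;> omega

theorem IsHorizontalStrip.card_eq (h : IsHorizontalStrip μ ν) :
    ν.card = μ.card + (stripColumns μ ν).card := by
  have hμ : μ.rowLen 0 ≤ ν.rowLen 0 := rowLen_zero_le_iff.2 <| by
    have hle := le_iff_colLen_le.1 h.le (ν.rowLen 0)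
    rw [colLen_eq_zero_of_rowLen_le le_rfl] at hle
    omega
  rw [card_eq_sum_colLen le_rfl, card_eq_sum_colLen hμ,
    Finset.sum_congr rfl fun j _ => h.colLen_eq j, Finset.sum_add_distrib, Finset.sum_boole,
    Finset.filter_mem_eq_inter, Finset.inter_eq_right.2 (stripColumns_subset le_rfl), Nat.cast_id]

theorem exists_isHorizontalStrip_stripColumns_eq {S : Finset ℕ}
    (hS : Antitone fun j => μ.colLen j + if j ∈ S then 1 else 0) :
    ∃ ν, IsHorizontalStrip μ ν ∧ stripColumns μ ν = S := by
  obtain ⟨n, hSn⟩ := S.exists_nat_subset_range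
  have hn : μ.colLen (max n (μ.rowLen 0)) + (if max n (μ.rowLen 0) ∈ S then 1 else 0) = 0 := by
    rw [colLen_eq_zero_of_rowLen_le (le_max_right _ _),
      if_neg fun h => (Finset.mem_range.1 (hSn h)).not_ge (le_max_left _ _)]
  obtain ⟨ν, hν⟩ := exists_colLen_eq hS hn
  refine ⟨ν, ⟨le_iff_colLen_le.2 fun j => ?_, fun j => ?_⟩, ?_⟩
  · rw [hν]; exact Nat.le_add_right _ _
  · rw [hν]; split_ifs <;> omega
  · ext j
    rw [mem_stripColumns, hν]
    split_ifs with hj <;> simp [hj]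

end Young

section Pieri

variable {A : Type*} [CommRing A]

/-- The Schur function `det (e_{μ'_i + j - i})` given by the dual Jacobi–Trudi formula. -/
def schurDet (e : ℕ → A) (μ : YoungDiagram) : A := jacobiTrudi e (μ.rowLen 0) μ.colLen

theorem schurDet_eq_jacobiTrudi {e : ℕ → A} (he : e 0 = 1) {μ : YoungDiagram} {n : ℕ}
    (hn : μ.rowLen 0 ≤ n) : schurDet e μ = jacobiTrudi e n μ.colLen :=
  (jacobiTrudi_eq_of_le he hn fun _ => colLen_eq_zero_of_rowLen_le).symm

theorem jacobiTrudi_eq_zero_of_not_antitone (e : ℕ → A) {μ : YoungDiagram} {n : ℕ} {S : Finset ℕ}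
    (hSn : S ⊆ Finset.range n)
    (hS : ¬ Antitone fun j => μ.colLen j + if j ∈ S then 1 else 0) :
    jacobiTrudi e n (fun j => μ.colLen j + if j ∈ S then 1 else 0) = 0 := by
  obtain ⟨i, hi⟩ : ∃ i, μ.colLen i + (if i ∈ S then 1 else 0) <
      μ.colLen (i + 1) + if i + 1 ∈ S then 1 else 0 := by
    contrapose! hS
    exact antitone_nat_of_succ_le hS
  have hanti := μ.colLen_anti i (i + 1) (Nat.le_succ i)
  have hmem : i + 1 ∈ S := by
    by_contra hmem
    rw [if_neg hmem] at hi
    omega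
  refine jacobiTrudi_eq_zero_of_succ_eq e (Finset.mem_range.1 (hSn hmem)) ?_
  rw [if_pos hmem] at hi ⊢
  omega

open Finset Classical in
theorem IsElementaryCompletePair.mul_schurDet {e h : ℕ → A}
    (hp : IsElementaryCompletePair e h) (k : ℕ) (μ : YoungDiagram) :
    h k * schurDet e μ =
      ∑ ν ∈ (youngDiagramsOfCard (μ.card + k)).filter (IsHorizontalStrip μ), schurDet e ν := by
  have hrow : ∀ {ν : YoungDiagram}, ν.card = μ.card + k → ν.rowLen 0 ≤ μ.card + k :=
    fun hν => hν ▸ rowLen_zero_le_card _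
  rw [schurDet_eq_jacobiTrudi hp.e_zero ((rowLen_zero_le_card μ).trans (Nat.le_add_right _ k)),
    hp.mul_jacobiTrudi fun i hi => colLen_eq_zero_of_rowLen_le ((rowLen_zero_le_card μ).trans hi)]
  symm
  refine sum_of_injOn (stripColumns μ) ?_ ?_ ?_ ?_
  · intro ν hν ν' hν' heq
    simp only [coe_filter, mem_youngDiagramsOfCard, Set.mem_ofPred_eq] at hν hν'
    exact eq_of_colLen_eq fun j => by rw [hν.2.colLen_eq, hν'.2.colLen_eq, heq]
  · intro ν hν
    simp only [coe_filter, mem_youngDiagramsOfCard, Set.mem_ofPred_eq] at hν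
    have hcard := hν.2.card_eq
    exact mem_coe.2 (mem_powersetCard.2 ⟨stripColumns_subset (hrow hν.1), by omega⟩)
  · intro S hS hnotMem
    obtain ⟨hSn, hSk⟩ := mem_powersetCard.1 hS
    refine jacobiTrudi_eq_zero_of_not_antitone e hSn fun hanti => hnotMem ?_
    obtain ⟨ν, hν, rfl⟩ := exists_isHorizontalStrip_stripColumns_eq hanti
    exact ⟨ν, by simp [hν, hν.card_eq, hSk], rfl⟩
  · intro ν hν
    rw [mem_filter, mem_youngDiagramsOfCard] at hν
    rw [schurDet_eq_jacobiTrudi hp.e_zero (hrow hν.1)]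
    exact congrArg _ (funext hν.2.colLen_eq)

end Pieri

/-! ### Contents of semistandard tableaux and Kostka numbers -/

section Kostka

variable {μ ν : YoungDiagram}

/-- The content of a semistandard tableau: the number of occurrences of each entry. -/
noncomputable def tableauContent (T : SemistandardYoungTableau μ) : ℕ →₀ ℕ :=
  ∑ x ∈ μ.cells, Finsupp.single (T x.1 x.2) 1

theorem tableauContent_apply (T : SemistandardYoungTableau μ) (a : ℕ) :
    tableauContent T a = (μ.cells.filter fun x => T x.1 x.2 = a).card := by
  simp [tableauContent, Finsupp.finsetSum_apply, Finsupp.single_apply]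

theorem degree_tableauContent (T : SemistandardYoungTableau μ) :
    (tableauContent T).degree = μ.card := by
  simp [tableauContent, YoungDiagram.card]

theorem mem_support_tableauContent (T : SemistandardYoungTableau μ) {i j : ℕ} (h : (i, j) ∈ μ) :
    T i j ∈ (tableauContent T).support := by
  rw [Finsupp.mem_support_iff, tableauContent_apply]
  exact Finset.card_ne_zero_of_mem (a := (i, j)) (by simp [h])

theorem finite_setOf_tableauContent_eq (μ : YoungDiagram) (m : ℕ →₀ ℕ) :
    {T : SemistandardYoungTableau μ | tableauContent T = m}.Finite := by
  let entries : {T : SemistandardYoungTableau μ // tableauContent T = m} → μ.cells → m.support :=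
    fun T x => ⟨T.1 x.1.1 x.1.2, by
      have := mem_support_tableauContent T.1 (μ.mem_cells _ |>.1 x.2)
      rwa [T.2] at this⟩
  have hinj : entries.Injective := by
    refine fun T T' h => Subtype.ext <| SemistandardYoungTableau.ext fun i j => ?_
    by_cases hx : (i, j) ∈ μ
    · exact congrArg Subtype.val (congrFun h ⟨(i, j), (μ.mem_cells _).2 hx⟩)
    · rw [T.1.zeros hx, T'.1.zeros hx]
  exact Set.finite_coe_iff.1 (Finite.of_injective entries hinj)

/-- The Kostka number: the number of semistandard tableaux of shape `μ` and content `m`. -/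
noncomputable def kostka (μ : YoungDiagram) (m : ℕ →₀ ℕ) : ℕ :=
  {T : SemistandardYoungTableau μ | tableauContent T = m}.ncard

theorem kostka_ne_zero_iff {m : ℕ →₀ ℕ} :
    kostka μ m ≠ 0 ↔ ∃ T : SemistandardYoungTableau μ, tableauContent T = m :=
  Nat.pos_iff_ne_zero.symm.trans (Set.ncard_pos (finite_setOf_tableauContent_eq μ m))

theorem kostka_eq_zero_of_card_ne {m : ℕ →₀ ℕ} (h : μ.card ≠ m.degree) : kostka μ m = 0 := by
  contrapose! h
  obtain ⟨T, rfl⟩ := kostka_ne_zero_iff.1 h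
  exact (degree_tableauContent T).symm

theorem kostka_bot_zero : kostka ⊥ 0 = 1 := by
  rw [kostka, Set.ncard_eq_one]
  refine ⟨SemistandardYoungTableau.highestWeight ⊥, Set.eq_singleton_iff_unique_mem.2 ⟨?_, ?_⟩⟩
  · simp [tableauContent]
  · intro T _
    ext i j
    rw [T.zeros (YoungDiagram.notMem_bot _),
      SemistandardYoungTableau.zeros _ (YoungDiagram.notMem_bot _)]

/-- The shape formed by the cells of a tableau whose entry is less than `r`. -/
def shapeBelow (T : SemistandardYoungTableau μ) (r : ℕ) : YoungDiagram where
  cells := μ.cells.filter fun x => T x.1 x.2 < r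
  isLowerSet := by
    rintro ⟨i, j⟩ ⟨i', j'⟩ ⟨hi, hj⟩ h
    simp only [Finset.coe_filter, YoungDiagram.mem_cells, Set.mem_ofPred_eq] at h hi hj ⊢
    exact ⟨μ.up_left_mem hi hj h.1, (T.row_weak_of_le hj (μ.up_left_mem hi le_rfl h.1)).trans_lt
      ((T.col_weak hi h.1).trans_lt h.2)⟩

theorem mem_shapeBelow {T : SemistandardYoungTableau μ} {r i j : ℕ} :
    (i, j) ∈ shapeBelow T r ↔ (i, j) ∈ μ ∧ T i j < r := by
  rw [← YoungDiagram.mem_cells]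
  simp [shapeBelow]

theorem shapeBelow_le (T : SemistandardYoungTableau μ) (r : ℕ) : shapeBelow T r ≤ μ :=
  fun _ hx => (mem_shapeBelow.1 hx).1

theorem isHorizontalStrip_shapeBelow {T : SemistandardYoungTableau ν} {r : ℕ}
    (hT : ∀ {i j}, (i, j) ∈ ν → T i j ≤ r) : IsHorizontalStrip (shapeBelow T r) ν where
  le := shapeBelow_le T r
  colLen_le_succ j := by
    by_contra! hlt
    have hbelow := YoungDiagram.mem_iff_lt_colLen.2 hlt
    have hmem : ((shapeBelow T r).colLen j, j) ∈ shapeBelow T r :=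
      mem_shapeBelow.2 ⟨ν.up_left_mem (Nat.le_succ _) le_rfl hbelow,
        (T.col_strict (Nat.lt_succ_self _) hbelow).trans_le (hT hbelow)⟩
    exact (YoungDiagram.mem_iff_lt_colLen.1 hmem).false

/-- The restriction of a tableau to a smaller shape. -/
def restrictTableau (T : SemistandardYoungTableau ν) (h : μ ≤ ν) :
    SemistandardYoungTableau μ where
  entry i j := if (i, j) ∈ μ then T i j else 0
  row_weak' {i j₁ j₂} hj hx := by
    rw [if_pos hx, if_pos (μ.up_left_mem le_rfl hj.le hx)]
    exact T.row_weak hj (h hx)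
  col_strict' {i₁ i₂ j} hi hx := by
    rw [if_pos hx, if_pos (μ.up_left_mem hi.le le_rfl hx)]
    exact T.col_strict hi (h hx)
  zeros' hx := if_neg hx

theorem restrictTableau_apply (T : SemistandardYoungTableau ν) (h : μ ≤ ν) {i j : ℕ}
    (hx : (i, j) ∈ μ) : restrictTableau T h i j = T i j :=
  if_pos hx

theorem tableauContent_restrictTableau_shapeBelow (T : SemistandardYoungTableau ν) (r : ℕ) :
    tableauContent (restrictTableau T (shapeBelow_le T r)) =
      (tableauContent T).filter (· < r) := by
  ext a
  have hfilter : ((shapeBelow T r).cells.filter fun x =>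
      restrictTableau T (shapeBelow_le T r) x.1 x.2 = a) =
        ν.cells.filter fun x => T x.1 x.2 < r ∧ T x.1 x.2 = a := by
    rw [← Finset.filter_filter]
    exact Finset.filter_congr fun x hx => by rw [restrictTableau_apply _ _ (by simpa using hx)]
  rw [tableauContent_apply, hfilter, Finsupp.filter_apply]
  split_ifs with ha
  · rw [tableauContent_apply]
    exact congrArg _ (Finset.filter_congr fun x _ => and_iff_right_of_imp fun h => h ▸ ha)
  · exact Finset.card_eq_zero.2 (Finset.filter_false_of_mem fun x _ h => ha (h.2 ▸ h.1))

/-- The extension of a tableau with entries less than `r` by a horizontal strip filled with the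
entry `r`. -/
def extendTableau (T : SemistandardYoungTableau μ) (h : IsHorizontalStrip μ ν) (r : ℕ)
    (hT : ∀ {i j}, (i, j) ∈ μ → T i j < r) : SemistandardYoungTableau ν where
  entry i j := if (i, j) ∈ μ then T i j else if (i, j) ∈ ν then r else 0
  row_weak' {i j₁ j₂} hj hx := by
    rw [if_pos (ν.up_left_mem le_rfl hj.le hx), if_pos hx]
    split_ifs with h₁ h₂ h₂
    · exact T.row_weak hj h₂
    · exact (hT h₁).le
    · exact absurd (μ.up_left_mem le_rfl hj.le h₂) h₁
    · exact le_rfl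
  col_strict' {i₁ i₂ j} hi hx := by
    rw [if_pos (ν.up_left_mem hi.le le_rfl hx), if_pos hx]
    split_ifs with h₁ h₂ h₂
    · exact T.col_strict hi h₂
    · exact hT h₁
    · exact absurd (μ.up_left_mem hi.le le_rfl h₂) h₁
    · rw [YoungDiagram.mem_iff_lt_colLen] at h₁ hx
      have := h.colLen_le_succ j
      omega
  zeros' {i j} hx := by rw [if_neg fun hx' => hx (h.le hx'), if_neg hx]

section Extend

variable {T : SemistandardYoungTableau μ} {h : IsHorizontalStrip μ ν} {r : ℕ}
  {hT : ∀ {i j}, (i, j) ∈ μ → T i j < r}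

theorem extendTableau_apply_of_mem {i j : ℕ} (hx : (i, j) ∈ μ) :
    extendTableau T h r hT i j = T i j :=
  if_pos hx

theorem extendTableau_apply_of_notMem {i j : ℕ} (hx : (i, j) ∈ ν) (hx' : (i, j) ∉ μ) :
    extendTableau T h r hT i j = r :=
  (if_neg hx').trans (if_pos hx)

theorem shapeBelow_extendTableau : shapeBelow (extendTableau T h r hT) r = μ := by
  ext ⟨i, j⟩
  rw [YoungDiagram.mem_cells, YoungDiagram.mem_cells, mem_shapeBelow]
  refine ⟨fun ⟨hx, hlt⟩ => ?_, fun hx => ⟨h.le hx, ?_⟩⟩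
  · by_contra hx'
    exact (extendTableau_apply_of_notMem hx hx' ▸ hlt).false
  · rw [extendTableau_apply_of_mem hx]
    exact hT hx

theorem restrictTableau_extendTableau : restrictTableau (extendTableau T h r hT) h.le = T := by
  ext i j
  by_cases hx : (i, j) ∈ μ
  · rw [restrictTableau_apply _ _ hx, extendTableau_apply_of_mem hx]
  · rw [T.zeros hx, SemistandardYoungTableau.zeros _ hx]

theorem tableauContent_extendTableau : tableauContent (extendTableau T h r hT) =
    tableauContent T + Finsupp.single r (ν.card - μ.card) := by
  have hsub : μ.cells ⊆ ν.cells := YoungDiagram.cells_subset_iff.2 h.le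
  rw [tableauContent, tableauContent, ← Finset.sum_sdiff hsub, add_comm]
  congr 1
  · exact Finset.sum_congr rfl fun x hx => by
      rw [extendTableau_apply_of_mem (by simpa using hx)]
  · rw [Finset.sum_congr rfl fun x hx => by
      rw [extendTableau_apply_of_notMem (by simp_all) (by simp_all)]]
    simp [Finset.card_sdiff_of_subset hsub, YoungDiagram.card]

end Extend

theorem extendTableau_restrictTableau {T : SemistandardYoungTableau ν} {r : ℕ}
    (hT : ∀ {i j}, (i, j) ∈ ν → T i j ≤ r) (h : IsHorizontalStrip μ ν)
    (hμ : shapeBelow T r = μ) (hr : ∀ {i j}, (i, j) ∈ μ → restrictTableau T h.le i j < r) :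
    extendTableau (restrictTableau T h.le) h r hr = T := by
  ext i j
  by_cases hx : (i, j) ∈ ν
  · by_cases hx' : (i, j) ∈ μ
    · rw [extendTableau_apply_of_mem hx', restrictTableau_apply _ _ hx']
    · rw [extendTableau_apply_of_notMem hx hx']
      exact le_antisymm (not_lt.1 fun hlt => hx' (hμ ▸ mem_shapeBelow.2 ⟨hx, hlt⟩)) (hT hx)
  · rw [T.zeros hx, SemistandardYoungTableau.zeros _ hx]

theorem filter_lt_add_single {m : ℕ →₀ ℕ} {r : ℕ} (hm : ∀ a ∈ m.support, a < r) (k : ℕ) :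
    (m + Finsupp.single r k).filter (· < r) = m := by
  rw [Finsupp.filter_add, Finsupp.filter_single_of_neg (· < r) (lt_irrefl r), add_zero,
    (Finsupp.filter_eq_self_iff _ _).2 fun a ha => hm a (Finsupp.mem_support_iff.2 ha)]

theorem le_of_tableauContent_eq_add_single {T : SemistandardYoungTableau μ} {m : ℕ →₀ ℕ}
    {r k : ℕ} (hm : ∀ a ∈ m.support, a < r) (hT : tableauContent T = m + Finsupp.single r k)
    {i j : ℕ} (hx : (i, j) ∈ μ) : T i j ≤ r := by
  have hmem := mem_support_tableauContent T hx
  rw [hT] at hmem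
  rcases Finset.mem_union.1 (Finsupp.support_add hmem) with hmem | hmem
  · exact (hm _ hmem).le
  · exact (Finset.mem_singleton.1 (Finsupp.support_single_subset hmem)).le

theorem ncard_setOf_shapeBelow_eq {m : ℕ →₀ ℕ} {r k : ℕ} (hm : ∀ a ∈ m.support, a < r)
    (h : IsHorizontalStrip μ ν) (hk : ν.card = μ.card + k) :
    {T : SemistandardYoungTableau ν |
      tableauContent T = m + Finsupp.single r k ∧ shapeBelow T r = μ}.ncard = kostka μ m := by
  have hlt : ∀ {T : SemistandardYoungTableau μ}, tableauContent T = m →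
      ∀ {i j}, (i, j) ∈ μ → T i j < r := fun hT _ _ hx =>
    hm _ (hT ▸ mem_support_tableauContent _ hx)
  have hrestrict : ∀ T : SemistandardYoungTableau ν,
      tableauContent T = m + Finsupp.single r k ∧ shapeBelow T r = μ →
        tableauContent (restrictTableau T h.le) = m := by
    rintro T ⟨hT, rfl⟩
    rw [tableauContent_restrictTableau_shapeBelow, hT, filter_lt_add_single hm]
  refine Set.ncard_congr (fun T _ => restrictTableau T h.le) hrestrict ?_ ?_
  · intro T T' hT hT' heq
    rw [← extendTableau_restrictTableau (le_of_tableauContent_eq_add_single hm hT.1) h hT.2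
        (hlt (hrestrict T hT)),
      ← extendTableau_restrictTableau (le_of_tableauContent_eq_add_single hm hT'.1) h hT'.2
        (hlt (hrestrict T' hT'))]
    congr 1
  · intro T hT
    refine ⟨extendTableau T h r (hlt hT), ⟨?_, shapeBelow_extendTableau⟩,
      restrictTableau_extendTableau⟩
    rw [tableauContent_extendTableau, hT, hk, Nat.add_sub_cancel_left]

open Finset Classical in
/-- Removing the largest entry `r` from a tableau. -/
theorem kostka_add_single {m : ℕ →₀ ℕ} {r k : ℕ} (hm : ∀ a ∈ m.support, a < r)
    (hν : ν.card = m.degree + k) :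
    kostka ν (m + Finsupp.single r k) =
      ∑ μ ∈ (youngDiagramsOfCard m.degree).filter (IsHorizontalStrip · ν), kostka μ m := by
  have hfin := finite_setOf_tableauContent_eq ν (m + Finsupp.single r k)
  have hmaps : ∀ T ∈ hfin.toFinset, shapeBelow T r ∈
      (youngDiagramsOfCard m.degree).filter (IsHorizontalStrip · ν) := by
    intro T hT
    rw [Set.Finite.mem_toFinset] at hT
    refine mem_filter.2 ⟨?_, isHorizontalStrip_shapeBelow
      (le_of_tableauContent_eq_add_single hm hT)⟩
    rw [mem_youngDiagramsOfCard,
      ← degree_tableauContent (restrictTableau T (shapeBelow_le T r)),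
      tableauContent_restrictTableau_shapeBelow, hT, filter_lt_add_single hm]
  rw [kostka, Set.ncard_eq_toFinset_card _ hfin, card_eq_sum_card_fiberwise hmaps]
  refine sum_congr rfl fun μ hμ => ?_
  rw [mem_filter, mem_youngDiagramsOfCard] at hμ
  rw [← ncard_setOf_shapeBelow_eq hm hμ.2 (hν.trans (congrArg (· + k) hμ.1.symm)),
    ← Set.ncard_coe_finset]
  congr 1
  ext T
  simp

theorem youngDiagramsOfCard_zero : youngDiagramsOfCard 0 = {⊥} := by
  ext μ
  rw [mem_youngDiagramsOfCard, Finset.mem_singleton, YoungDiagram.card, Finset.card_eq_zero,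
    YoungDiagram.ext_iff, YoungDiagram.cells_bot]

theorem schurDet_bot {A : Type*} [CommRing A] (e : ℕ → A) : schurDet e ⊥ = 1 := by
  have hrow : (⊥ : YoungDiagram).rowLen 0 = 0 :=
    Nat.le_zero.1 ((rowLen_zero_le_card ⊥).trans (by simp [YoungDiagram.card]))
  rw [schurDet, hrow, jacobiTrudi, Matrix.det_isEmpty]

open Finset Classical in
/-- Induction on the largest variable, by the Pieri rule. -/
theorem IsElementaryCompletePair.prod_eq_sum_kostka_mul_schurDet {A : Type*} [CommRing A]
    {e h : ℕ → A} (hp : IsElementaryCompletePair e h) (m : ℕ →₀ ℕ) :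
    (m.prod fun _ k => h k) =
      ∑ μ ∈ youngDiagramsOfCard m.degree, (kostka μ m : A) * schurDet e μ := by
  induction m using Finsupp.induction_on_max with
  | zero => simp [youngDiagramsOfCard_zero, kostka_bot_zero, schurDet_bot]
  | single_add r k m hm _ ih =>
    have hdisj : Disjoint (Finsupp.single r k).support m.support :=
      (disjoint_singleton_left.2 fun hr => (hm r hr).false).mono_left
        Finsupp.support_single_subset
    calc ((Finsupp.single r k + m).prod fun _ k => h k)
        = ∑ μ ∈ youngDiagramsOfCard m.degree, h k * (kostka μ m * schurDet e μ) := by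
          rw [Finsupp.prod_add_index_of_disjoint hdisj, Finsupp.prod_single_index hp.h_zero, ih,
            mul_sum]
      _ = ∑ μ ∈ youngDiagramsOfCard m.degree, ∑ ν ∈ youngDiagramsOfCard (m.degree + k),
            if IsHorizontalStrip μ ν then (kostka μ m : A) * schurDet e ν else 0 :=
          sum_congr rfl fun μ hμ => by
            rw [mul_left_comm, hp.mul_schurDet, mul_sum, sum_filter,
              mem_youngDiagramsOfCard.1 hμ]
      _ = ∑ ν ∈ youngDiagramsOfCard (m.degree + k),
            (kostka ν (m + Finsupp.single r k) : A) * schurDet e ν := by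
          rw [sum_comm]
          refine sum_congr rfl fun ν hν => ?_
          rw [kostka_add_single hm (mem_youngDiagramsOfCard.1 hν), ← sum_filter, Nat.cast_sum,
            sum_mul]
      _ = _ := by rw [add_comm m, map_add, Finsupp.degree_single, add_comm k]

end Kostka

/-! ### Linear independence of the Schur functions -/

section LinearIndependence

variable {μ ν : YoungDiagram}

theorem fst_le_tableau_apply (T : SemistandardYoungTableau μ) {i j : ℕ} (h : (i, j) ∈ μ) :
    i ≤ T i j := by
  induction i with
  | zero => exact Nat.zero_le _
  | succ i ih =>
    exact (ih (μ.up_left_mem i.le_succ le_rfl h)).trans_lt (T.col_strict i.lt_succ_self h)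

theorem weight_id_tableauContent (T : SemistandardYoungTableau μ) :
    Finsupp.weight id (tableauContent T) = ∑ x ∈ μ.cells, T x.1 x.2 := by
  simp [tableauContent, Finsupp.weight_single]

theorem tableauContent_highestWeight_apply (μ : YoungDiagram) (i : ℕ) :
    tableauContent (.highestWeight μ) i = μ.rowLen i := by
  rw [tableauContent_apply, YoungDiagram.rowLen_eq_card, YoungDiagram.row]
  congr 1
  exact Finset.filter_congr fun x hx => by simp [(μ.mem_cells x).1 hx]

theorem tableauContent_highestWeight_injective :
    Function.Injective fun μ : YoungDiagram =>
      tableauContent (SemistandardYoungTableau.highestWeight μ) := by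
  intro μ ν h
  ext ⟨i, j⟩
  have hrow := DFunLike.congr_fun h i
  simp only [tableauContent_highestWeight_apply] at hrow
  rw [YoungDiagram.mem_cells, YoungDiagram.mem_cells, YoungDiagram.mem_iff_lt_rowLen,
    YoungDiagram.mem_iff_lt_rowLen, hrow]

theorem kostka_highestWeight_ne_zero (μ : YoungDiagram) :
    kostka μ (tableauContent (.highestWeight μ)) ≠ 0 :=
  kostka_ne_zero_iff.2 ⟨_, rfl⟩

/-- The entries in row `i` are at least `i`, with equality throughout only for the tableau of
highest weight. -/
theorem weight_highestWeight_lt_of_kostka_ne_zero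
    (h : kostka μ (tableauContent (.highestWeight ν)) ≠ 0) (hne : μ ≠ ν) :
    Finsupp.weight id (tableauContent (SemistandardYoungTableau.highestWeight μ)) <
      Finsupp.weight id (tableauContent (SemistandardYoungTableau.highestWeight ν)) := by
  obtain ⟨T, hT⟩ := kostka_ne_zero_iff.1 h
  have hle : ∀ x ∈ μ.cells, SemistandardYoungTableau.highestWeight μ x.1 x.2 ≤ T x.1 x.2 := by
    intro x hx
    rw [YoungDiagram.mem_cells] at hx
    rw [SemistandardYoungTableau.highestWeight_apply, if_pos hx]
    exact fst_le_tableau_apply T hx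
  rw [← hT, weight_id_tableauContent, weight_id_tableauContent]
  refine (Finset.sum_le_sum hle).lt_of_ne fun heq => hne ?_
  rw [Finset.sum_eq_sum_iff_of_le hle] at heq
  refine tableauContent_highestWeight_injective (Eq.trans ?_ hT)
  exact Finset.sum_congr rfl fun x hx => by rw [heq x hx]

theorem coeff_schurFunction (μ : YoungDiagram) (m : ℕ →₀ ℕ) :
    MvPowerSeries.coeff m (schurFunction μ) = kostka μ m := rfl

theorem coeff_sum_smul_schurFunction (c : YoungDiagram →₀ ℤ) (m : ℕ →₀ ℕ) :
    MvPowerSeries.coeff m (c.sum fun μ a => a • schurFunction μ) =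
      c.sum fun μ a => a * kostka μ m := by
  rw [Finsupp.sum, map_sum]
  exact Finset.sum_congr rfl fun μ _ => by rw [map_zsmul, coeff_schurFunction, smul_eq_mul]

theorem linearIndependent_schurFunction : LinearIndependent ℤ schurFunction := by
  rw [linearIndependent_iff]
  intro c hc
  by_contra hne
  obtain ⟨ν, hν, hmin⟩ := Finset.exists_min_image c.support
    (fun μ => Finsupp.weight id (tableauContent (SemistandardYoungTableau.highestWeight μ)))
    (Finsupp.support_nonempty_iff.2 hne)
  have hsingle : ∀ μ ∈ c.support, μ ≠ ν →
      c μ * (kostka μ (tableauContent (.highestWeight ν)) : ℤ) = 0 := by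
    intro μ hμ hμν
    by_contra h
    exact (hmin μ hμ).not_gt <| weight_highestWeight_lt_of_kostka_ne_zero
      (Nat.cast_ne_zero.1 (right_ne_zero_of_mul h)) hμν
  have hcoeff := congrArg
    (MvPowerSeries.coeff (tableauContent (SemistandardYoungTableau.highestWeight ν))) hc
  rw [Finsupp.linearCombination_apply, coeff_sum_smul_schurFunction, map_zero, Finsupp.sum,
    Finset.sum_eq_single_of_mem ν hν hsingle] at hcoeff
  exact (mul_ne_zero (Finsupp.mem_support_iff.1 hν)
    (Nat.cast_ne_zero.2 (kostka_highestWeight_ne_zero ν))) hcoeff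

end LinearIndependence

/-! ### Coefficients of products of complete symmetric functions in the letters -/

section Words

variable {N : ℕ}

theorem wordMonomial_nil : (wordMonomial [] : FreeAlg N) = 1 := rfl

theorem wordMonomial_mul (v w : KRWord N) :
    wordMonomial v * wordMonomial w = wordMonomial (v ++ w) := by
  rw [wordMonomial, wordMonomial, MonoidAlgebra.single_mul_single, mul_one, wordMonomial,
    FreeMonoid.ofList_append]

theorem coeff_wordMonomial (v w : KRWord N) :
    (wordMonomial v).coeff (FreeMonoid.ofList w) = if v = w then 1 else 0 := by
  classical
  rw [wordMonomial, MonoidAlgebra.coeff_single, Finsupp.single_apply]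
  simp

theorem coeff_mul_wordMonomial (f : FreeAlg N) (x y v : KRWord N) (h : v.length = y.length) :
    (f * wordMonomial v).coeff (FreeMonoid.ofList (x ++ y)) =
      if v = y then f.coeff (FreeMonoid.ofList x) else 0 := by
  split_ifs with hv
  · subst hv
    rw [wordMonomial, MonoidAlgebra.coeff_mul_single_eq_coeff_mul (FreeMonoid.ofList x), mul_one]
    exact fun _ _ => by rw [FreeMonoid.ofList_append, mul_left_inj]
  · refine MonoidAlgebra.coeff_mul_single_of_forall_mul_ne _ _ fun d hd => hv ?_
    exact List.append_inj_right' (congrArg FreeMonoid.toList hd) h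

theorem coeff_mul_wordMonomial_of_length_lt (f : FreeAlg N) {v w : KRWord N}
    (h : w.length < v.length) : (f * wordMonomial v).coeff (FreeMonoid.ofList w) = 0 := by
  refine MonoidAlgebra.coeff_mul_single_of_forall_mul_ne _ _ fun d hd => ?_
  have hlen := congrArg (fun x => (FreeMonoid.toList x).length) hd
  simp only [FreeMonoid.toList_mul, FreeMonoid.toList_ofList, List.length_append] at hlen
  omega

/-- The generator `u_a` of the free associative algebra. -/
noncomputable def letterMonomial (a : Fin N) : FreeAlg N := wordMonomial [a]

theorem listElementary_letterMonomial (l : List (Fin N)) (k : ℕ) :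
    listElementary letterMonomial l k = ((l.sublistsLen k).map wordMonomial).sum := by
  induction l generalizing k with
  | nil => cases k <;> simp [listElementary, wordMonomial_nil]
  | cons a l ih =>
    cases k with
    | zero => simp [wordMonomial_nil]
    | succ k =>
      rw [listElementary_cons_succ, List.sublistsLen_succ_cons, List.map_append, List.sum_append,
        ih, ih, ← List.sum_map_mul_left, List.map_map]
      congr 2
      refine List.map_congr_left fun v _ => ?_
      rw [letterMonomial, wordMonomial_mul, Function.comp_apply, List.singleton_append]

theorem listComplete_letterMonomial (l : List (Fin N)) (k : ℕ) :
    listComplete letterMonomial l k =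
      ((l.sublistsLen k).map fun v => wordMonomial v.reverse).sum := by
  induction l generalizing k with
  | nil => cases k <;> simp [listComplete, wordMonomial_nil]
  | cons a l ih =>
    cases k with
    | zero => simp [wordMonomial_nil]
    | succ k =>
      rw [listComplete_cons_succ, List.sublistsLen_succ_cons, List.map_append, List.sum_append,
        ih, ih, ← List.sum_map_mul_right, List.map_map]
      congr 2
      refine List.map_congr_left fun v _ => ?_
      rw [letterMonomial, wordMonomial_mul, Function.comp_apply, List.reverse_cons]

/-- The letters of the alphabet in decreasing order, which is the order of the factors in the
elementary symmetric functions. -/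
def letters (N : ℕ) : List (Fin N) := (List.finRange N).reverse

theorem pairwise_letters (N : ℕ) : (letters N).Pairwise (· > ·) :=
  List.pairwise_reverse.2 (List.pairwise_lt_finRange N)

theorem sublist_letters_iff {w : KRWord N} : w.Sublist (letters N) ↔ w.Pairwise (· > ·) := by
  refine ⟨fun h => (pairwise_letters N).sublist h, fun h => ?_⟩
  refine List.sublist_of_subperm_of_pairwise (r := (· > ·)) ?_ h (pairwise_letters N)
  exact List.subperm_of_subset (h.imp fun h => h.ne') fun a _ => by simp [letters]

/-- The strictly decreasing words of length `k`. -/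
def decreasingWords (N k : ℕ) : Finset (KRWord N) := ((letters N).sublistsLen k).toFinset

theorem mem_decreasingWords {w : KRWord N} {k : ℕ} :
    w ∈ decreasingWords N k ↔ w.Pairwise (· > ·) ∧ w.length = k := by
  rw [decreasingWords, List.mem_toFinset, List.mem_sublistsLen, sublist_letters_iff]

theorem nodup_sublistsLen_letters (N k : ℕ) : ((letters N).sublistsLen k).Nodup :=
  List.nodup_sublistsLen _ ((pairwise_letters N).imp fun h => h.ne')

theorem listElementary_letters (k : ℕ) :
    listElementary letterMonomial (letters N) k = ∑ v ∈ decreasingWords N k, wordMonomial v := by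
  rw [listElementary_letterMonomial, decreasingWords,
    List.sum_toFinset _ (nodup_sublistsLen_letters N k)]

theorem listComplete_letters (k : ℕ) :
    listComplete letterMonomial (letters N) k =
      ∑ v ∈ decreasingWords N k, wordMonomial v.reverse := by
  rw [listComplete_letterMonomial, decreasingWords,
    List.sum_toFinset _ (nodup_sublistsLen_letters N k)]

theorem ncElementary_natCast (k : ℕ) :
    ncElementary N k = listElementary letterMonomial (letters N) k := by
  classical
  rw [ncElementary, if_pos k.cast_nonneg, listElementary_letters, Int.toNat_natCast]
  refine Finset.sum_bij (fun i _ => List.ofFn i) ?_ (fun _ _ _ _ h => List.ofFn_injective h) ?_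
    fun _ _ => rfl
  · intro i hi
    rw [mem_decreasingWords, List.pairwise_ofFn]
    exact ⟨fun a b hab => (Finset.mem_filter.1 hi).2 hab, List.length_ofFn⟩
  · intro w hw
    obtain ⟨hanti, rfl⟩ := mem_decreasingWords.1 hw
    exact ⟨w.get, Finset.mem_filter.2 ⟨Finset.mem_univ _, List.pairwise_iff_get.1 hanti⟩,
      List.ofFn_get w⟩

theorem ncElementary_eq_extendByZero (d : ℤ) :
    ncElementary N d = extendByZero (listElementary letterMonomial (letters N)) d := by
  rcases lt_or_ge d 0 with hd | hd
  · rw [ncElementary, if_neg hd.not_ge, extendByZero_of_neg _ hd]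
  · lift d to ℕ using hd
    rw [ncElementary_natCast, extendByZero_natCast]

theorem coeff_mul_listComplete (f : FreeAlg N) (x y : KRWord N) [Decidable (y.Pairwise (· < ·))] :
    (f * listComplete letterMonomial (letters N) y.length).coeff (FreeMonoid.ofList (x ++ y)) =
      if y.Pairwise (· < ·) then f.coeff (FreeMonoid.ofList x) else 0 := by
  have hcoeff : ∀ v ∈ decreasingWords N y.length,
      (f * wordMonomial v.reverse).coeff (FreeMonoid.ofList (x ++ y)) =
        if v = y.reverse then f.coeff (FreeMonoid.ofList x) else 0 := by
    intro v hv
    rw [coeff_mul_wordMonomial _ _ _ _ (by simp [(mem_decreasingWords.1 hv).2])]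
    simp only [List.reverse_eq_iff]
  rw [listComplete_letters, Finset.mul_sum, MonoidAlgebra.coeff_sum, Finsupp.finsetSum_apply,
    Finset.sum_congr rfl hcoeff, Finset.sum_ite_eq']
  simp [mem_decreasingWords, List.pairwise_reverse]

theorem coeff_mul_listComplete_of_length_lt (f : FreeAlg N) {w : KRWord N} {k : ℕ}
    (h : w.length < k) :
    (f * listComplete letterMonomial (letters N) k).coeff (FreeMonoid.ofList w) = 0 := by
  rw [listComplete_letters, Finset.mul_sum, MonoidAlgebra.coeff_sum, Finsupp.finsetSum_apply]
  refine Finset.sum_eq_zero fun v hv => coeff_mul_wordMonomial_of_length_lt _ ?_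
  rwa [List.length_reverse, (mem_decreasingWords.1 hv).2]

/-- The weakly increasing list over `{0, …, r - 1}` in which `i` occurs `m i` times. -/
def contentList (m : ℕ → ℕ) (r : ℕ) : List ℕ :=
  (List.range r).flatMap fun i => List.replicate (m i) i

theorem contentList_succ (m : ℕ → ℕ) (r : ℕ) :
    contentList m (r + 1) = contentList m r ++ List.replicate (m r) r := by
  simp [contentList, List.range_succ]

theorem lt_of_mem_contentList {m : ℕ → ℕ} {r a : ℕ} (h : a ∈ contentList m r) : a < r := by
  simp only [contentList, List.mem_flatMap, List.mem_range, List.mem_replicate] at h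
  obtain ⟨i, hi, -, rfl⟩ := h
  exact hi

theorem pairwise_contentList (m : ℕ → ℕ) (r : ℕ) : (contentList m r).Pairwise (· ≤ ·) := by
  induction r with
  | zero => simp [contentList]
  | succ r ih =>
    rw [contentList_succ, List.pairwise_append]
    refine ⟨ih, by simp [List.pairwise_replicate], fun a ha b hb => ?_⟩
    rw [List.eq_of_mem_replicate hb]
    exact (lt_of_mem_contentList ha).le

theorem count_contentList (m : ℕ → ℕ) (r a : ℕ) :
    (contentList m r).count a = if a < r then m a else 0 := by
  induction r with
  | zero => simp [contentList]
  | succ r ih =>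
    rw [contentList_succ, List.count_append, ih, List.count_replicate]
    rcases lt_trichotomy a r with h | rfl | h
    · simp [h, h.ne', h.trans r.lt_succ_self]
    · simp
    · simp [h.ne, h.not_gt, (Nat.succ_le_of_lt h).not_gt]

theorem toFinsupp_contentList {m : ℕ →₀ ℕ} {r : ℕ} (hr : ∀ a ∈ m.support, a < r) :
    Multiset.toFinsupp (contentList m r : Multiset ℕ) = m := by
  ext a
  rw [Multiset.toFinsupp_apply, Multiset.coe_count, count_contentList, ite_eq_left_iff]
  exact fun h => (Finsupp.notMem_support_iff.1 fun ha => h (hr a ha)).symm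

theorem pairwise_zip_replicate_iff {r : ℕ} {y : KRWord N} :
    ((List.replicate y.length r).zip y).Pairwise (Prod.Lex (· < ·) (· < ·)) ↔
      y.Pairwise (· < ·) := by
  have hzip : (List.replicate y.length r).zip y = y.map (Prod.mk r) := by
    induction y with
    | nil => rfl
    | cons a y ih => simpa [List.replicate_succ] using ih
  rw [hzip, List.pairwise_map]
  simp [Prod.lex_def]

theorem pairwise_zip_contentList_append_iff {m : ℕ → ℕ} {r : ℕ} {x y : KRWord N}
    (hx : (contentList m r).length = x.length) :
    ((contentList m r ++ List.replicate y.length r).zip (x ++ y)).Pairwise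
        (Prod.Lex (· < ·) (· < ·)) ↔
      ((contentList m r).zip x).Pairwise (Prod.Lex (· < ·) (· < ·)) ∧ y.Pairwise (· < ·) := by
  rw [List.zip_append hx, List.pairwise_append, pairwise_zip_replicate_iff, ← and_assoc,
    and_iff_left]
  intro a ha b hb
  refine Prod.lex_def.2 (Or.inl ?_)
  rw [List.eq_of_mem_replicate (List.of_mem_zip hb).1]
  exact lt_of_mem_contentList (List.of_mem_zip ha).1

/-- A factor `h_k` of the product contributes the strictly increasing words of length `k`, so a
word occurs iff it splits into increasing blocks of lengths `m 0, …, m (r - 1)`. -/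
theorem coeff_prod_listComplete (m : ℕ → ℕ) (r : ℕ) (w : KRWord N)
    [Decidable (((contentList m r).zip w).Pairwise (Prod.Lex (· < ·) (· < ·)))] :
    (((List.range r).map fun i => listComplete letterMonomial (letters N) (m i)).prod).coeff
        (FreeMonoid.ofList w) =
      if (contentList m r).length = w.length ∧
        ((contentList m r).zip w).Pairwise (Prod.Lex (· < ·) (· < ·)) then 1 else 0 := by
  classical
  induction r generalizing w with
  | zero =>
    rw [List.range_zero, List.map_nil, List.prod_nil, ← wordMonomial_nil, coeff_wordMonomial]
    simp [contentList, eq_comm]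
  | succ r ih =>
    simp only [List.range_succ, List.map_append, List.prod_append, List.map_singleton,
      List.prod_singleton, contentList_succ, List.length_append, List.length_replicate]
    by_cases hlt : w.length < m r
    · rw [coeff_mul_listComplete_of_length_lt _ hlt, if_neg fun h => by omega]
    · obtain ⟨x, y, rfl, hy⟩ : ∃ x y, w = x ++ y ∧ y.length = m r :=
        ⟨w.take (w.length - m r), w.drop (w.length - m r), by simp, by simp; omega⟩
      simp only [← hy, coeff_mul_listComplete, ih, ← ite_and, List.length_append,
        Nat.add_right_cancel_iff]
      refine if_congr ?_ rfl rfl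
      by_cases hx : (contentList m r).length = x.length
      · rw [pairwise_zip_contentList_append_iff hx]
        tauto
      · simp [hx]

/-! ### Coefficients of fundamental quasisymmetric functions -/

theorem toFinsupp_coe_ofFn {n : ℕ} (i : Fin n → ℕ) :
    Multiset.toFinsupp (List.ofFn i : Multiset ℕ) = ∑ j, Finsupp.single (i j) 1 := by
  induction n with
  | zero => simp
  | succ n ih =>
    rw [List.ofFn_succ, Fin.sum_univ_succ, ← ih, ← Multiset.cons_coe, ← Multiset.singleton_add,
      map_add, Multiset.toFinsupp_singleton]

theorem sum_single_eq_iff_perm_contentList {n : ℕ} {m : ℕ →₀ ℕ} {r : ℕ}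
    (hr : ∀ a ∈ m.support, a < r) (i : Fin n → ℕ) :
    ∑ j, Finsupp.single (i j) 1 = m ↔ (List.ofFn i).Perm (contentList m r) := by
  rw [← Multiset.coe_eq_coe, ← Multiset.toFinsupp.injective.eq_iff, toFinsupp_contentList hr,
    toFinsupp_coe_ofFn]

theorem monotone_iff_pairwise_ofFn {n : ℕ} {i : Fin n → ℕ} :
    Monotone i ↔ (List.ofFn i).Pairwise (· ≤ ·) := by
  rw [← List.sortedLE_ofFn_iff, List.sortedLE_iff_pairwise]

theorem lex_lt_iff_of_le {α β : Type*} [LinearOrder α] [LinearOrder β] {a b : α} {x y : β}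
    (hab : a ≤ b) (hxy : x ≠ y) :
    Prod.Lex (· < ·) (· < ·) (a, x) (b, y) ↔ (y < x → a < b) := by
  rw [Prod.lex_def]
  rcases hab.eq_or_lt with rfl | hab
  · simp [hxy.le_iff_lt]
  · simp [hab]

theorem pairwise_zip_ofFn_iff {w : KRWord N} (hw : w.Nodup) {i : Fin w.length → ℕ}
    (hi : Monotone i) :
    ((List.ofFn i).zip w).Pairwise (Prod.Lex (· < ·) (· < ·)) ↔
      ∀ (j : ℕ) (h : j + 1 < w.length), j + 1 ∈ descentSet w →
        i ⟨j, Nat.lt_of_succ_lt h⟩ < i ⟨j + 1, h⟩ := by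
  have hlen : ((List.ofFn i).zip w).length = w.length := by simp
  have hstep : ∀ (j : ℕ) (hj : j + 1 < w.length),
      Prod.Lex (· < ·) (· < ·) (((List.ofFn i).zip w)[j]'(by omega))
          (((List.ofFn i).zip w)[j + 1]'(by omega)) ↔
        (j + 1 ∈ descentSet w → i ⟨j, Nat.lt_of_succ_lt hj⟩ < i ⟨j + 1, hj⟩) := by
    intro j hj
    have hne : w[j] ≠ w[j + 1] := fun h => by
      have := hw.getElem_inj_iff.1 h
      omega
    have hdes : j + 1 ∈ descentSet w ↔ w[j + 1] < w[j] := by simp [descentSet, hj]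
    rw [List.getElem_zip, List.getElem_zip, List.getElem_ofFn, List.getElem_ofFn,
      lex_lt_iff_of_le (hi (by simp)) hne, hdes]
  rw [← List.isChain_iff_pairwise, List.isChain_iff_getElem]
  exact ⟨fun h j hj => (hstep j hj).1 (h j (hlen.symm ▸ hj)),
    fun h j hj => (hstep j (hlen ▸ hj)).2 (h j _)⟩

theorem mem_fundamentalQuasisymmetric_iff {w : KRWord N} (hw : w.Nodup) {m : ℕ →₀ ℕ} {r : ℕ}
    (hr : ∀ a ∈ m.support, a < r) (i : Fin w.length → ℕ) :
    (Monotone i ∧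
      (∀ (j : ℕ) (h : j + 1 < w.length), j + 1 ∈ descentSet w →
        i ⟨j, Nat.lt_of_succ_lt h⟩ < i ⟨j + 1, h⟩) ∧
      ∑ j, Finsupp.single (i j) 1 = m) ↔
    List.ofFn i = contentList m r ∧
      ((contentList m r).zip w).Pairwise (Prod.Lex (· < ·) (· < ·)) := by
  rw [sum_single_eq_iff_perm_contentList hr]
  constructor
  · rintro ⟨hi, hdes, hperm⟩
    have heq := hperm.eq_of_pairwise' (monotone_iff_pairwise_ofFn.1 hi) (pairwise_contentList m r)
    exact ⟨heq, heq ▸ (pairwise_zip_ofFn_iff hw hi).2 hdes⟩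
  · rintro ⟨heq, hlex⟩
    have hi : Monotone i := monotone_iff_pairwise_ofFn.2 (heq ▸ pairwise_contentList m r)
    exact ⟨hi, (pairwise_zip_ofFn_iff hw hi).1 (heq ▸ hlex), heq ▸ List.Perm.refl _⟩

theorem ncard_setOf_ofFn_eq {α : Type*} {n : ℕ} (l : List α) :
    {i : Fin n → α | List.ofFn i = l}.ncard = if l.length = n then 1 else 0 := by
  split_ifs with h
  · subst h
    refine Set.ncard_eq_one.2 ⟨l.get, Set.eq_singleton_iff_unique_mem.2 ⟨List.ofFn_get l, ?_⟩⟩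
    exact fun i hi => List.ofFn_injective (hi.trans (List.ofFn_get l).symm)
  · have hempty : {i : Fin n → α | List.ofFn i = l} = ∅ :=
      Set.eq_empty_of_forall_notMem fun i (hi : List.ofFn i = l) => h (hi ▸ List.length_ofFn)
    rw [hempty, Set.ncard_empty]

theorem coeff_fundamentalQuasisymmetric {w : KRWord N} (hw : w.Nodup) {m : ℕ →₀ ℕ} {r : ℕ}
    (hr : ∀ a ∈ m.support, a < r) :
    MvPowerSeries.coeff m (fundamentalQuasisymmetric w.length (descentSet w)) =
      (((List.range r).map fun i => listComplete letterMonomial (letters N) (m i)).prod).coeff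
        (FreeMonoid.ofList w) := by
  classical
  rw [coeff_prod_listComplete]
  change ((Set.ncard _ : ℕ) : ℤ) = _
  simp only [mem_fundamentalQuasisymmetric_iff hw hr]
  by_cases hlex : ((contentList m r).zip w).Pairwise (Prod.Lex (· < ·) (· < ·))
  · simp [hlex, ncard_setOf_ofFn_eq]
  · simp [hlex]

end Words

/-! ### Homogeneity of the noncommutative Schur functions -/

section Homogeneous

variable {N : ℕ}

/-- The homogeneous elements of degree `d` of the free associative algebra. The degree is an
integer because the indices of `ncElementary` are. -/
noncomputable def homogeneousPart (N : ℕ) (d : ℤ) : Submodule ℤ (FreeAlg N) :=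
  Submodule.span ℤ (wordMonomial '' {w | (w.length : ℤ) = d})

theorem wordMonomial_mem_homogeneousPart {w : KRWord N} {d : ℤ} (h : (w.length : ℤ) = d) :
    wordMonomial w ∈ homogeneousPart N d :=
  Submodule.subset_span (Set.mem_image_of_mem _ h)

instance : SetLike.GradedMonoid (homogeneousPart N) where
  one_mem := wordMonomial_mem_homogeneousPart rfl
  mul_mem d d' f g hf hg := by
    have hmul := Submodule.mul_mem_mul hf hg
    rw [homogeneousPart, homogeneousPart, Submodule.span_mul_span] at hmul
    refine Submodule.span_mono ?_ hmul
    rintro _ ⟨_, ⟨v, rfl, rfl⟩, _, ⟨w, rfl, rfl⟩, rfl⟩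
    exact ⟨v ++ w, by simp, (wordMonomial_mul v w).symm⟩

theorem ncElementary_mem_homogeneousPart (d : ℤ) : ncElementary N d ∈ homogeneousPart N d := by
  rw [ncElementary]
  split_ifs with hd
  · refine sum_mem fun i _ => wordMonomial_mem_homogeneousPart ?_
    rw [List.length_ofFn, Int.toNat_of_nonneg hd]
  · exact zero_mem _

theorem ncSchur_mem_homogeneousPart (μ : YoungDiagram) :
    ncSchur N μ ∈ homogeneousPart N μ.card := by
  refine sum_mem fun π _ => Submodule.smul_mem _ _ ?_
  have hprod := SetLike.list_prod_ofFn_mem_graded _ _ fun j : Fin (μ.rowLen 0) =>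
    ncElementary_mem_homogeneousPart (N := N)
      ((μ.colLen j : ℤ) + ((π j : ℕ) : ℤ) - ((j : ℕ) : ℤ))
  have hdegree : ∑ j : Fin (μ.rowLen 0), ((μ.colLen j : ℤ) + ((π j : ℕ) : ℤ) - ((j : ℕ) : ℤ)) =
      μ.card := by
    rw [Finset.sum_sub_distrib, Finset.sum_add_distrib,
      Equiv.sum_comp π fun j : Fin (μ.rowLen 0) => ((j : ℕ) : ℤ), add_sub_cancel_right,
      card_eq_sum_colLen le_rfl, ← Fin.sum_univ_eq_sum_range μ.colLen, Nat.cast_sum]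
  rwa [List.sum_ofFn, hdegree] at hprod

end Homogeneous

/-! ### Functionals on rings and their largest ideals -/

section KernelIdeal

variable {A B : Type*} [Ring A] [AddCommGroup B]

/-- The largest two-sided ideal on which an additive functional vanishes. -/
def kernelIdeal (φ : A →+ B) : TwoSidedIdeal A :=
  TwoSidedIdeal.mk' {f | ∀ p q, φ (p * f * q) = 0} (fun p q => by simp)
    (fun hf hg p q => by rw [mul_add, add_mul, map_add, hf, hg, add_zero])
    (fun hf p q => by rw [mul_neg, neg_mul, map_neg, hf, neg_zero])
    (fun hg p q => by rw [← mul_assoc, hg])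
    (fun hf p q => by rw [← mul_assoc, mul_assoc _ _ q, hf])

theorem mem_kernelIdeal {φ : A →+ B} {f : A} :
    f ∈ kernelIdeal φ ↔ ∀ p q, φ (p * f * q) = 0 :=
  TwoSidedIdeal.mem_mk' ..

theorem kernelIdeal_mk_eq_zero_iff {φ : A →+ B} {f : A} :
    (kernelIdeal φ).ringCon.mk' f = 0 ↔ ∀ p q, φ (p * f * q) = 0 := by
  rw [← mem_kernelIdeal, TwoSidedIdeal.mem_iff, ← map_zero (kernelIdeal φ).ringCon.mk']
  exact RingCon.eq _

/-- The functional induced on the quotient by `kernelIdeal φ`. -/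
def kernelIdealLift (φ : A →+ B) : (kernelIdeal φ).ringCon.Quotient →+ B :=
  (kernelIdeal φ).ringCon.toAddCon.lift φ fun f g hfg => by
    have hker := mem_kernelIdeal.1 ((TwoSidedIdeal.rel_iff _ f g).1 hfg) 1 1
    rwa [one_mul, mul_one, map_sub, sub_eq_zero] at hker

theorem kernelIdealLift_mk (φ : A →+ B) (f : A) :
    kernelIdealLift φ ((kernelIdeal φ).ringCon.mk' f) = φ f := rfl

end KernelIdeal

/-! ### Pairing with an element orthogonal to the KR relations -/

section Pairing

variable {N : ℕ}

theorem wordPairing_comm (f g : FreeAlg N) : wordPairing f g = wordPairing g f := by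
  classical
  rw [wordPairing, wordPairing,
    Finsupp.sum_of_support_subset f.coeff Finset.subset_union_left _ (by simp),
    Finsupp.sum_of_support_subset g.coeff Finset.subset_union_right _ (by simp)]
  exact Finset.sum_congr rfl fun _ _ => mul_comm _ _

/-- The pairing with a fixed element of the free associative algebra. -/
noncomputable def pairingHom (γ : FreeAlg N) : FreeAlg N →+ ℤ where
  toFun f := wordPairing f γ
  map_zero' := by simp [wordPairing]
  map_add' f g := Finsupp.sum_add_index' (by simp) fun _ _ _ => add_mul _ _ _

theorem pairingHom_apply (γ f : FreeAlg N) : pairingHom γ f = wordPairing f γ := rfl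

theorem pairingHom_wordMonomial (γ : FreeAlg N) (w : KRWord N) :
    pairingHom γ (wordMonomial w) = γ.coeff (FreeMonoid.ofList w) := by
  simp [pairingHom_apply, wordPairing, wordMonomial]

theorem addMonoidHom_eq_zero_of_wordMonomial {B : Type*} [AddCommGroup B] {φ : FreeAlg N →+ B}
    (h : ∀ w, φ (wordMonomial w) = 0) : φ = 0 := by
  refine MonoidAlgebra.addMonoidHom_ext fun w r => ?_
  have hsingle : MonoidAlgebra.single w r = r • wordMonomial w.toList := by
    rw [wordMonomial, MonoidAlgebra.smul_single]
    simp
  rw [hsingle, map_zsmul, h, smul_zero, AddMonoidHom.zero_apply]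

theorem forall_mul_mul_eq_zero_of_wordMonomial {B : Type*} [AddCommGroup B] {φ : FreeAlg N →+ B}
    {f : FreeAlg N} (h : ∀ v w, φ (wordMonomial v * f * wordMonomial w) = 0) (p q : FreeAlg N) :
    φ (p * f * q) = 0 := by
  have hright : ∀ v, φ.comp (AddMonoidHom.mulLeft (wordMonomial v * f)) = 0 := fun v =>
    addMonoidHom_eq_zero_of_wordMonomial (h v)
  have hleft : φ.comp ((AddMonoidHom.mulRight q).comp (AddMonoidHom.mulRight f)) = 0 :=
    addMonoidHom_eq_zero_of_wordMonomial fun v => DFunLike.congr_fun (hright v) q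
  exact DFunLike.congr_fun hleft p

/-- An element of the free associative algebra that is orthogonal to the ideal of the KR
relations: it involves no word with a repeated letter, and its coefficients on the two diagonals
of each KR square have the same sum. -/
structure IsKRBalanced (γ : FreeAlg N) : Prop where
  nodup {w : KRWord N} : γ.coeff (FreeMonoid.ofList w) ≠ 0 → w.Nodup
  coeff_add_coeff (v w : KRWord N) {a b c : Fin N} : a < b → b < c →
    γ.coeff (FreeMonoid.ofList (insertTriple v w b a c)) +
        γ.coeff (FreeMonoid.ofList (insertTriple v w c a b)) =
      γ.coeff (FreeMonoid.ofList (insertTriple v w b c a)) +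
        γ.coeff (FreeMonoid.ofList (insertTriple v w a c b))

/-- The generating function `∑_w γ_w Q_{Des(w)}` of an element `∑_w γ_w w` of the free associative
algebra. -/
noncomputable def wordGeneratingFunction (γ : FreeAlg N) : MvPowerSeries ℕ ℤ :=
  γ.coeff.sum fun w a => a • fundamentalQuasisymmetric w.toList.length (descentSet w.toList)

theorem wordMonomial_insertTriple (v w : KRWord N) (x y z : Fin N) :
    wordMonomial (insertTriple v w x y z) = wordMonomial v *
      (letterMonomial x * letterMonomial y * letterMonomial z) * wordMonomial w := by
  simp [letterMonomial, wordMonomial_mul, insertTriple]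

/-- A letter of the free associative algebra modulo the largest ideal orthogonal to `γ`. -/
noncomputable def letterClass (γ : FreeAlg N) (a : Fin N) :
    (kernelIdeal (pairingHom γ)).ringCon.Quotient :=
  (kernelIdeal (pairingHom γ)).ringCon.mk' (letterMonomial a)

namespace IsKRBalanced

variable {γ : FreeAlg N}

theorem pairingHom_mul_letter_mul_letter_mul (hγ : IsKRBalanced γ) (a : Fin N)
    (f p q : FreeAlg N) :
    pairingHom γ (p * (letterMonomial a * f * letterMonomial a) * q) = 0 := by
  refine forall_mul_mul_eq_zero_of_wordMonomial (fun v w => ?_) p q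
  have hword : ∀ x, pairingHom γ (wordMonomial v * letterMonomial a * wordMonomial x *
      (letterMonomial a * wordMonomial w)) = 0 := by
    intro x
    simp only [letterMonomial, wordMonomial_mul, pairingHom_wordMonomial]
    by_contra hne
    exact absurd (hγ.nodup hne) (by simp [List.nodup_append])
  have hzero : (pairingHom γ).comp
      ((AddMonoidHom.mulRight (letterMonomial a * wordMonomial w)).comp
        (AddMonoidHom.mulLeft (wordMonomial v * letterMonomial a))) = 0 :=
    addMonoidHom_eq_zero_of_wordMonomial hword
  simpa [mul_assoc] using DFunLike.congr_fun hzero f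

theorem pairingHom_mul_lie_mul (hγ : IsKRBalanced γ) {a b c : Fin N} (hab : a < b) (hbc : b < c)
    (p q : FreeAlg N) :
    pairingHom γ (p * ⁅letterMonomial b, ⁅letterMonomial a, letterMonomial c⁆⁆ * q) = 0 := by
  refine forall_mul_mul_eq_zero_of_wordMonomial (fun v w => ?_) p q
  have hexpand : wordMonomial v * ⁅letterMonomial b, ⁅letterMonomial a, letterMonomial c⁆⁆ *
        wordMonomial w =
      wordMonomial (insertTriple v w b a c) + wordMonomial (insertTriple v w c a b) -
        (wordMonomial (insertTriple v w b c a) + wordMonomial (insertTriple v w a c b)) := by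
    simp only [wordMonomial_insertTriple, Ring.lie_def]
    noncomm_ring
  rw [hexpand, map_sub, map_add, map_add, pairingHom_wordMonomial, pairingHom_wordMonomial,
    pairingHom_wordMonomial, pairingHom_wordMonomial, hγ.coeff_add_coeff v w hab hbc, sub_self]

theorem satisfiesKR (hγ : IsKRBalanced γ) : SatisfiesKR (letterClass γ) where
  mul_mul_self a x := by
    obtain ⟨f, rfl⟩ := RingCon.mk'_surjective _ x
    rw [letterClass, ← map_mul, ← map_mul, kernelIdeal_mk_eq_zero_iff]
    exact hγ.pairingHom_mul_letter_mul_letter_mul a f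
  commute_lie hab hbc := by
    rw [commute_iff_lie_eq]
    simp only [letterClass, Ring.lie_def, ← map_mul, ← map_sub]
    rw [kernelIdeal_mk_eq_zero_iff]
    exact hγ.pairingHom_mul_lie_mul hab hbc

end IsKRBalanced

theorem wordPairing_eq_zero_of_mem_homogeneousPart {f γ : FreeAlg N} {d : ℤ}
    (hf : f ∈ homogeneousPart N d)
    (hγ : ∀ w : KRWord N, γ.coeff (FreeMonoid.ofList w) ≠ 0 → (w.length : ℤ) ≠ d) :
    wordPairing f γ = 0 := by
  have hle : homogeneousPart N d ≤ (pairingHom γ).toIntLinearMap.ker := by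
    refine Submodule.span_le.2 ?_
    rintro _ ⟨w, hw, rfl⟩
    rw [SetLike.mem_coe, LinearMap.mem_ker, AddMonoidHom.coe_toIntLinearMap,
      pairingHom_wordMonomial]
    exact not_not.1 fun hne => hγ w hne hw
  exact hle hf

theorem coeff_wordGeneratingFunction {γ : FreeAlg N} (hγ : IsKRBalanced γ) {m : ℕ →₀ ℕ} {r : ℕ}
    (hr : ∀ a ∈ m.support, a < r) :
    MvPowerSeries.coeff m (wordGeneratingFunction γ) = pairingHom γ
      (((List.range r).map fun i => listComplete letterMonomial (letters N) (m i)).prod) := by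
  rw [pairingHom_apply, wordPairing_comm, wordGeneratingFunction, wordPairing, Finsupp.sum,
    map_sum]
  refine Finset.sum_congr rfl fun w hw => ?_
  rw [map_zsmul, smul_eq_mul, coeff_fundamentalQuasisymmetric
    (hγ.nodup (w := w.toList) (Finsupp.mem_support_iff.1 hw)) hr, FreeMonoid.ofList_toList]

end Pairing

/-! ### Partial D₀ graphs -/

section PartialD0Graphs

variable {N n : ℕ}

theorem insertTriple_inj {v w : KRWord N} {x y z x' y' z' : Fin N} :
    insertTriple v w x y z = insertTriple v w x' y' z' ↔ x = x' ∧ y = y' ∧ z = z' := by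
  simp [insertTriple]

theorem nodup_insertTriple_iff_of_perm (v w : KRWord N) {x y z x' y' z' : Fin N}
    (h : [x, y, z].Perm [x', y', z']) :
    (insertTriple v w x y z).Nodup ↔ (insertTriple v w x' y' z').Nodup :=
  ((h.append_left v).append_right w).nodup_iff

theorem KRPossibility.Occurs.indicator_add_indicator {W : Set (KRWord N)}
    {E : SimpleGraph (KRWord N)} {v w : KRWord N} {a b c : Fin N} {p : KRPossibility}
    (hp : p.Occurs W E v w a b c) (hab : a < b) (hbc : b < c) :
    W.indicator (1 : KRWord N → ℤ) (insertTriple v w b a c) +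
        W.indicator 1 (insertTriple v w c a b) =
      W.indicator 1 (insertTriple v w b c a) + W.indicator 1 (insertTriple v w a c b) := by
  classical
  have hX : ∀ x ∈ krSquare v w a b c,
      W.indicator (1 : KRWord N → ℤ) x = (krSquare v w a b c ∩ W).indicator 1 x :=
    fun x hx => by simp [Set.indicator_apply, hx]
  have hac := hab.trans hbc
  rw [hX _ (by simp [krSquare]), hX _ (by simp [krSquare]), hX _ (by simp [krSquare]),
    hX _ (by simp [krSquare])]
  cases p with
  | disjoint =>
    rw [show krSquare v w a b c ∩ W = ∅ from hp]
    simp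
  | knuthPair | rotationPair =>
    rcases hp with ⟨hp, -⟩ | ⟨hp, -⟩ <;>
    simp [hp, insertTriple_inj, hab.ne, hbc.ne, hac.ne, hab.ne', hbc.ne',
      hac.ne']
  | knuthFull | rotationFull | undetermined =>
    rw [Set.inter_eq_left.2 hp.1]
    simp [krSquare]

namespace PartialD0Graph

theorem coeff_vertexSum (H : PartialD0Graph N n) (w : KRWord N) :
    H.vertexSum.coeff (FreeMonoid.ofList w) = (H.verts : Set (KRWord N)).indicator 1 w := by
  classical
  simp [vertexSum, MonoidAlgebra.coeff_sum, coeff_wordMonomial, Set.indicator_apply]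

theorem isKRBalanced_vertexSum (H : PartialD0Graph N n) : IsKRBalanced H.vertexSum where
  nodup {w} hw := by
    rw [coeff_vertexSum] at hw
    exact H.nodup w (Set.mem_of_indicator_ne_zero hw)
  coeff_add_coeff v w a b c hab hbc := by
    simp only [coeff_vertexSum]
    by_cases hnd : (insertTriple v w a b c).Nodup
    · obtain ⟨p, hp, -⟩ := H.existsUnique_possibility v w a b c hab hbc hnd
      exact hp.indicator_add_indicator hab hbc
    · have hzero : ∀ {x y z}, [x, y, z].Perm [a, b, c] →
          (H.verts : Set (KRWord N)).indicator (1 : KRWord N → ℤ) (insertTriple v w x y z) = 0 :=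
        fun hperm => Set.indicator_of_notMem
          (fun hx => hnd ((nodup_insertTriple_iff_of_perm v w hperm).1 (H.nodup _ hx))) _
      have hacb : [a, c, b].Perm [a, b, c] := (List.Perm.swap ..).cons a
      have hbac : [b, a, c].Perm [a, b, c] := List.Perm.swap ..
      rw [hzero hacb, hzero hbac, hzero ((List.Perm.swap ..).trans hacb),
        hzero (((List.Perm.swap ..).cons b).trans hbac)]

theorem wordGeneratingFunction_vertexSum (H : PartialD0Graph N n) :
    wordGeneratingFunction H.vertexSum = H.generatingFunction := by
  rw [wordGeneratingFunction, vertexSum, MonoidAlgebra.coeff_sum, generatingFunction,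
    ← Finsupp.sum_finsetSum_index (by simp) fun _ _ _ => add_smul _ _ _]
  refine Finset.sum_congr rfl fun w hw => ?_
  simp [wordMonomial, H.length_eq w hw]

end PartialD0Graph

end PartialD0Graphs

/-! ### Schur expansions -/

section CommutativeModel

universe u

variable {A : Type u} [Ring A] {e h : ℕ → A}

theorem IsElementaryCompletePair.complete_mem_closure (hp : IsElementaryCompletePair e h) (k : ℕ) :
    h k ∈ Subring.closure (Set.range e) := by
  induction k using Nat.strong_induction_on with
  | _ k ih =>
    have hsign : ∀ j, (-1 : A) ^ j ∈ Subring.closure (Set.range e) := fun j =>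
      pow_mem (neg_mem (one_mem _)) j
    cases k with
    | zero => exact hp.h_zero ▸ one_mem _
    | succ k =>
      have hrel := hp.sum_eq_zero k
      rw [Finset.Nat.sum_antidiagonal_succ', hp.e_zero, mul_one, add_eq_zero_iff_eq_neg] at hrel
      have hmem : (-1) ^ (k + 1) * h (k + 1) ∈ Subring.closure (Set.range e) := by
        rw [hrel]
        refine neg_mem (sum_mem fun p hpk => ?_)
        rw [Finset.HasAntidiagonal.mem_antidiagonal] at hpk
        exact mul_mem (hsign _)
          (mul_mem (ih _ (by lia)) (Subring.subset_closure (Set.mem_range_self _)))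
      have hunsign := mul_mem (hsign (k + 1)) hmem
      rwa [← mul_assoc, ← pow_add, Even.neg_one_pow ⟨k + 1, rfl⟩, one_mul] at hunsign

open IsMulCommutative in
theorem IsElementaryCompletePair.exists_commRing (hp : IsElementaryCompletePair e h)
    (hcomm : ∀ j k, Commute (e j) (e k)) :
    ∃ (C : Type u) (_ : CommRing C) (ι : C →+* A) (e' h' : ℕ → C),
      IsElementaryCompletePair e' h' ∧ (∀ k, ι (e' k) = e k) ∧ ∀ k, ι (h' k) = h k := by
  have : IsMulCommutative (Subring.closure (Set.range e)) := by
    refine Subring.isMulCommutative_closure ?_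
    rintro _ ⟨j, rfl⟩ _ ⟨k, rfl⟩
    exact (hcomm j k).eq
  refine ⟨Subring.closure (Set.range e), inferInstance, Subring.subtype _,
    fun k => ⟨e k, Subring.subset_closure (Set.mem_range_self k)⟩,
    fun k => ⟨h k, hp.complete_mem_closure k⟩, ?_, fun _ => rfl, fun _ => rfl⟩
  exact
    { e_zero := Subtype.ext hp.e_zero
      h_zero := Subtype.ext hp.h_zero
      sum_eq_zero := fun k => Subtype.ext ((map_sum (Subring.subtype _) _ _).trans
        (hp.sum_eq_zero k)) }

theorem map_schurDet {N : ℕ} {A C : Type*} [Ring A] [CommRing C] {ι : C →+* A}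
    {π : FreeAlg N →+* A} {e : ℕ → C}
    (he : ∀ k, ι (e k) = π (listElementary letterMonomial (letters N) k)) (μ : YoungDiagram) :
    ι (schurDet e μ) = π (ncSchur N μ) := by
  have hentry : ∀ d, ι (extendByZero e d) = π (ncElementary N d) := by
    intro d
    rw [ncElementary_eq_extendByZero, extendByZero, extendByZero]
    split_ifs
    · exact he _
    · rw [map_zero, map_zero]
  rw [schurDet, jacobiTrudi, ← Matrix.det_transpose, Matrix.det_apply, ncSchur, map_sum, map_sum]
  refine Finset.sum_congr rfl fun σ _ => ?_
  rw [Units.smul_def, map_zsmul, map_zsmul, ← List.prod_ofFn, map_list_prod, map_list_prod,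
    List.map_ofFn, List.map_ofFn]
  congr 3
  funext j
  rw [Function.comp_apply, Function.comp_apply, ← hentry]
  rfl

theorem finsuppProd_eq_prod_map_range {M : Type*} [CommMonoid M] {h : ℕ → M} (h_zero : h 0 = 1)
    {m : ℕ →₀ ℕ} {r : ℕ} (hr : ∀ a ∈ m.support, a < r) :
    (m.prod fun _ k => h k) = ((List.range r).map fun i => h (m i)).prod := by
  rw [Finsupp.prod_of_support_subset m (fun a ha => Finset.mem_range.2 (hr a ha)) _
    fun _ _ => h_zero, ← List.toFinset_range, List.prod_toFinset _ List.nodup_range]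

end CommutativeModel

namespace IsKRBalanced

variable {N : ℕ} {γ : FreeAlg N}

theorem exists_commRing (hγ : IsKRBalanced γ) :
    ∃ (C : Type) (_ : CommRing C) (φ : C →+ ℤ) (e h : ℕ → C), IsElementaryCompletePair e h ∧
      (∀ m, MvPowerSeries.coeff m (wordGeneratingFunction γ) = φ (m.prod fun _ k => h k)) ∧
      ∀ μ, wordPairing (ncSchur N μ) γ = φ (schurDet e μ) := by
  have hu := hγ.satisfiesKR
  obtain ⟨C, _, ι, e, h, hp, he, hh⟩ :=
    (isElementaryCompletePair_list hu.mul_self (letters N)).exists_commRing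
      (hu.commute_listElementary (pairwise_letters N))
  refine ⟨C, inferInstance, (kernelIdealLift (pairingHom γ)).comp ι, e, h, hp, fun m => ?_,
    fun μ => ?_⟩
  · obtain ⟨r, hr⟩ : ∃ r, ∀ a ∈ m.support, a < r :=
      ⟨m.support.sup id + 1, fun a ha => Nat.lt_succ_of_le (Finset.le_sup (f := id) ha)⟩
    rw [coeff_wordGeneratingFunction hγ hr, finsuppProd_eq_prod_map_range hp.h_zero hr,
      ← kernelIdealLift_mk, map_list_prod (RingCon.mk' _), List.map_map]
    change _ = kernelIdealLift _ (ι _)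
    rw [map_list_prod ι, List.map_map]
    congr 3
    funext i
    exact (map_listComplete ..).trans (hh (m i)).symm
  · rw [← pairingHom_apply, ← kernelIdealLift_mk,
      ← map_schurDet fun k => (he k).trans (map_listElementary ..).symm]
    rfl

end IsKRBalanced

section SchurCoefficients

variable {N : ℕ}

open Classical in
/-- The coefficients `⟨𝔍_μ(u), γ⟩` as a finitely supported function of `μ`: they vanish unless
`|μ|` is the length of a word involved in `γ`. -/
noncomputable def schurCoefficients (γ : FreeAlg N) : YoungDiagram →₀ ℤ :=
  Finsupp.onFinset (γ.coeff.support.biUnion fun w => youngDiagramsOfCard w.toList.length)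
    (fun μ => wordPairing (ncSchur N μ) γ) fun μ hμ => by
      by_contra hmem
      refine hμ (wordPairing_eq_zero_of_mem_homogeneousPart (ncSchur_mem_homogeneousPart μ)
        fun w hw hcard => hmem (Finset.mem_biUnion.2 ⟨FreeMonoid.ofList w,
          Finsupp.mem_support_iff.2 hw, ?_⟩))
      exact mem_youngDiagramsOfCard.2 (Nat.cast_injective hcard).symm

theorem schurCoefficients_apply (γ : FreeAlg N) (μ : YoungDiagram) :
    schurCoefficients γ μ = wordPairing (ncSchur N μ) γ := rfl

theorem coeff_sum_smul_schurFunction_eq_sum_youngDiagramsOfCard (c : YoungDiagram →₀ ℤ)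
    (m : ℕ →₀ ℕ) :
    MvPowerSeries.coeff m (c.sum fun μ a => a • schurFunction μ) =
      ∑ μ ∈ youngDiagramsOfCard m.degree, c μ * kostka μ m := by
  classical
  rw [coeff_sum_smul_schurFunction, Finsupp.sum_of_support_subset c
    (Finset.subset_union_left (s₂ := youngDiagramsOfCard m.degree)) _ (by simp)]
  refine (Finset.sum_subset Finset.subset_union_right fun μ _ hμ => ?_).symm
  rw [kostka_eq_zero_of_card_ne (mt mem_youngDiagramsOfCard.2 hμ), Nat.cast_zero, mul_zero]

theorem IsKRBalanced.wordGeneratingFunction_eq_sum {γ : FreeAlg N} (hγ : IsKRBalanced γ) :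
    wordGeneratingFunction γ = (schurCoefficients γ).sum fun μ a => a • schurFunction μ := by
  obtain ⟨C, _, φ, e, h, hp, hcoeff, hschur⟩ := hγ.exists_commRing
  ext m
  rw [coeff_sum_smul_schurFunction_eq_sum_youngDiagramsOfCard, hcoeff,
    hp.prod_eq_sum_kostka_mul_schurDet, map_sum]
  refine Finset.sum_congr rfl fun μ _ => ?_
  rw [schurCoefficients_apply, hschur, ← nsmul_eq_mul, map_nsmul, nsmul_eq_mul, mul_comm]

theorem exists_forall_degree_le_of_coeff_sum_smul_schurFunction_ne_zero (c : YoungDiagram →₀ ℤ) :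
    ∃ d, ∀ m, MvPowerSeries.coeff m (c.sum fun μ a => a • schurFunction μ) ≠ 0 →
      m.degree ≤ d := by
  refine ⟨c.support.sup YoungDiagram.card, fun m hm => ?_⟩
  rw [coeff_sum_smul_schurFunction] at hm
  obtain ⟨μ, hμ, hne⟩ := Finset.exists_ne_zero_of_sum_ne_zero hm
  have hcard : μ.card = m.degree := by
    by_contra hcard
    exact hne (mul_eq_zero_of_right _ (by rw [kostka_eq_zero_of_card_ne hcard, Nat.cast_zero]))
  exact hcard ▸ Finset.le_sup hμ

theorem rename_eq_self_of_coeff_embDomain {ι R : Type*} [CommSemiring R] {F : MvPowerSeries ι R}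
    {σ : Equiv.Perm ι}
    (hF : ∀ m, MvPowerSeries.coeff (Finsupp.embDomain σ.toEmbedding m) F =
      MvPowerSeries.coeff m F) :
    MvPowerSeries.rename σ F = F := by
  ext m
  obtain ⟨m, rfl⟩ := Finsupp.mapDomain_surjective σ.surjective m
  have hm : Finsupp.mapDomain σ m = Finsupp.embDomain σ.toEmbedding m :=
    (Finsupp.embDomain_eq_mapDomain σ.toEmbedding m).symm
  rw [hm, hF]
  exact MvPowerSeries.coeff_embDomain_rename σ.toEmbedding F m

theorem IsKRBalanced.isSymmetricFunction_wordGeneratingFunction {γ : FreeAlg N}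
    (hγ : IsKRBalanced γ) : IsSymmetricFunction (wordGeneratingFunction γ) := by
  refine ⟨?_, fun σ => rename_eq_self_of_coeff_embDomain fun m => ?_⟩
  · rw [hγ.wordGeneratingFunction_eq_sum]
    exact exists_forall_degree_le_of_coeff_sum_smul_schurFunction_ne_zero _
  · obtain ⟨C, _, φ, e, h, -, hcoeff, -⟩ := hγ.exists_commRing
    rw [hcoeff, hcoeff, Finsupp.prod_embDomain]

end SchurCoefficients

theorem corollaryc_general (N : ℕ) (γ : FreeAlg N) (hγ : IsKRBalanced γ) :
    IsSymmetricFunction (wordGeneratingFunction γ) ∧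
      ∃ c : YoungDiagram →₀ ℤ,
        wordGeneratingFunction γ = (c.sum fun μ a => a • schurFunction μ) ∧
        (∀ c' : YoungDiagram →₀ ℤ,
          wordGeneratingFunction γ = (c'.sum fun μ a => a • schurFunction μ) → c' = c) ∧
        ∀ μ : YoungDiagram, c μ = wordPairing (ncSchur N μ) γ :=
  ⟨hγ.isSymmetricFunction_wordGeneratingFunction, schurCoefficients γ,
    hγ.wordGeneratingFunction_eq_sum,
    fun _ hc' => linearIndependent_schurFunction (hc'.symm.trans hγ.wordGeneratingFunction_eq_sum),
    schurCoefficients_apply γ⟩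

/-- The generating function of a partial D₀ graph `H` (in particular of a D₀ graph) is symmetric;
it is a linear combination of Schur functions in exactly one way, and the coefficient of `s_μ`
is `⟨𝔍_μ(u), ∑_{w ∈ V(H)} w⟩`. -/
theorem corollaryc (N n : ℕ) (H : PartialD0Graph N n) :
    IsSymmetricFunction H.generatingFunction ∧
      ∃ c : YoungDiagram →₀ ℤ,
        H.generatingFunction = (c.sum fun μ a => a • schurFunction μ) ∧
        (∀ c' : YoungDiagram →₀ ℤ,
          H.generatingFunction = (c'.sum fun μ a => a • schurFunction μ) → c' = c) ∧
        ∀ μ : YoungDiagram, c μ = wordPairing (ncSchur N μ) H.vertexSum := by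
  rw [← H.wordGeneratingFunction_vertexSum]
  exact corollaryc_general N _ H.isKRBalanced_vertexSum
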